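/- \textbf{Setting.} All Hilbert spaces are finite-dimensional. Parties $k\in\mathcal N=\{1,\dots,N\}$ have an incoming space $\mathcal H^{I_k}$ and an outgoing space $\mathcal H^{O_k}$. A CP map of party $k$ is represented by a positive semidefinite operator $M_k$ on $\mathcal H^{I_k}\otimes\mathcal H^{O_k}$; it is CPTP if moreover $\mathrm{Tr}_{O_k}M_k=\mathbb 1^{I_k}$. A \emph{process matrix} is an operator $W\ge 0$ on $\bigotimes_k(\mathcal H^{I_k}\otimes\mathcal H^{O_k})$ for which $\mathrm{Tr}[(M_1\otimes\dots\otimes M_N)W]$ takes the same value for all CPTP maps $M_1,\dots,M_N$ (no normalisation is imposed). For $\mathcal K\subseteq\mathcal N$, $W$ does not allow signalling to $\mathcal K$ if, for all CP maps of the parties in $\mathcal K$, $\mathrm{Tr}[(M_1\otimes\dots\otimes M_N)W]$ does not depend on the CPTP maps of the parties outside $\mathcal K$. A process matrix is compatible with party $k$ acting first if it does not allow signalling to $\{k\}$, and compatible with the order $X\prec Y\prec Z$ of three parties if it does not allow signalling to $\{X\}$ nor to $\{X,Y\}$. For $M_k\ge0$ put $W_{|M_k}=\mathrm{Tr}_k[(M_k\otimes\mathbb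 1)W]$, an operator for the parties other than $k$. \textbf{Definitions.} (i) (Oreshkov–Giarmatzi, OG) For $N=1$ every process matrix is OG-causally separable. For $N\ge2$, a process matrix $W$ is OG-causally separable if $W=\sum_k q_kW_{(k)}$ with $q_k\ge0$, $\sum_kq_k=1$, where each $W_{(k)}$ is a process matrix compatible with party $k$ acting first and such that $(W_{(k)})_{|M_k}$ is an OG-causally separable $(N-1)$-partite process matrix for every CP map $M_k$ of party $k$. (ii) $W$ is OG-extensibly causally separable if $W$ is OG-causally separable and so is $W\otimes\rho$, for all extra finite-dimensional incoming spaces of the parties and all states $\rho$ on their tensor product. (iii) (Araújo et al.) For three parties $A,B,C$ where $C$ has no outgoing system ($\dim\mathcal H^{O_C}=1$), a process matrix $W$ is Araújo-causally separable if $W=q\,W^{A\prec B\prec C}+(1-q)\,W^{B\prec A\prec C}$ with $q\in[0,1]$ and process matrices $W^{A\prec B\prec C}$, $W^{B\prec A\prec C}$ compatible with the indicated orders. A causal witness, in this scenario, is a Hermitian $S$ with $\mathrm{Tr}[SW]\ge0$ for every Araújo-causally separable $W$. \textbf{Proposition.} Consider three parties $A,B,C$ where $C$ has no outgoing system. (1)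 An operator $W$ is an Araújo-causally separable process matrix if and only if it is an OG-extensibly causally separable process matrix. (2) Araújo-causal separability is not equivalent to OG-causal separability. Let $\mathcal H^{C_I},\mathcal H^{A_I},\mathcal H^{B_I},\mathcal H^{A_O},\mathcal H^{B_O}$ be qubits, let $X,Y,Z$ be the Pauli matrices and $\mathbb 1$ the $2\times2$ identity, and write tensor products in the order $C_IA_IB_IA_OB_O$ with the symbol $\otimes$ omitted. Put \begin{align*} W^{\mathrm{act}}&=\tfrac18\Big[\mathbb 1(\mathbb{11}-ZZ)\mathbb{11}+\tfrac{\sqrt3}{4}\mathbb 1(XX+YY)(Z\mathbb 1+\mathbb 1Z)+\tfrac12Z(Z\mathbb 1-\mathbb 1Z)\mathbb{11}+\tfrac14X(XY-YX)(Z\mathbb 1-\mathbb 1Z)\Big],\\ S^{\mathrm{act}}&=\tfrac14\Big[\mathbb 1(\mathbb{11}-ZZ)(\mathbb{11}-ZZ)-\tfrac23\mathbb 1(XX+YY)(\mathbb 1Z+Z\mathbb 1)+\tfrac1{\sqrt3}Z(\mathbb 1Z-Z\mathbb 1)(\mathbb{11}-ZZ)\\ &\qquad+\tfrac1{\sqrt3}X(XY-YX)(\mathbb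 1Z-Z\mathbb 1)+\tfrac13Y(XX+YY)(\mathbb 1Z-Z\mathbb 1)\Big]. \end{align*} Then $W^{\mathrm{act}}$ is an OG-causally separable process matrix, $S^{\mathrm{act}}$ is a causal witness, and $\mathrm{Tr}[S^{\mathrm{act}}W^{\mathrm{act}}]=2-\tfrac4{\sqrt3}<0$. Hence $W^{\mathrm{act}}$ is neither Araújo-causally separable nor OG-extensibly causally separable. -/

import Mathlib

open scoped ComplexOrder Kronecker

namespace ProcMat

universe u v

/-! ### Parties, operations, and correlations

Party `k` of `N` has an incoming Hilbert space with orthonormal basis `I k` and an outgoing one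
with orthonormal basis `O k` (finite types). Operators on the tensor product of all these spaces
are matrices indexed by `Sys I O`. -/

/-- Basis of the tensor product of all incoming and outgoing spaces. -/
abbrev Sys {N : ℕ} (I : Fin N → Type u) (O : Fin N → Type v) : Type (max u v) :=
  ∀ k, I k × O k

/-- Operators on the tensor product of all incoming and outgoing spaces. -/
abbrev Op {N : ℕ} (I : Fin N → Type u) (O : Fin N → Type v) : Type (max u v) :=
  Matrix (Sys I O) (Sys I O) ℂ

/-- The Choi–Jamiołkowski matrix of a completely positive map. -/
def IsCP {X : Type u} {Y : Type v} (M : Matrix (X × Y) (X × Y) ℂ) : Prop :=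
  M.PosSemidef

/-- The Choi–Jamiołkowski matrix of a completely positive trace-preserving map from `X` to `Y`:
positive semidefinite, with the partial trace over the outgoing space equal to the identity. -/
def IsCPTP {X : Type u} {Y : Type v} [DecidableEq X] [Fintype Y]
    (M : Matrix (X × Y) (X × Y) ℂ) : Prop :=
  M.PosSemidef ∧ ∀ x x' : X, ∑ y, M (x, y) (x', y) = (1 : Matrix X X ℂ) x x'

/-- The tensor product `M₁ ⊗ ⋯ ⊗ M_N` of local operators. -/
def tensor {N : ℕ} {I : Fin N → Type u} {O : Fin N → Type v}
    (M : ∀ k, Matrix (I k × O k) (I k × O k) ℂ) : Op I O :=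
  Matrix.of fun i j => ∏ k, M k (i k) (j k)

section Correlations

variable {N : ℕ} {I : Fin N → Type u} {O : Fin N → Type v}
  [∀ k, Fintype (I k)] [∀ k, Fintype (O k)]

/-- The generalised Born rule `Tr[(M₁ ⊗ ⋯ ⊗ M_N) W]`. -/
def born (W : Op I O) (M : ∀ k, Matrix (I k × O k) (I k × O k) ℂ) : ℂ :=
  (tensor M * W).trace

variable [∀ k, DecidableEq (I k)]

/-- A (valid, not necessarily normalised) process matrix: positive semidefinite, and the total
probability does not depend on the CPTP maps applied by the parties. -/
def IsProcess (W : Op I O) : Prop :=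
  W.PosSemidef ∧
    ∀ M M' : ∀ k, Matrix (I k × O k) (I k × O k) ℂ,
      (∀ k, IsCPTP (M k)) → (∀ k, IsCPTP (M' k)) → born W M = born W M'

/-- No signalling from the parties outside `K` to the parties in `K`: for all CP maps of the
parties in `K`, the probability does not depend on the CPTP maps of the other parties. -/
def NoSignallingTo (K : Set (Fin N)) (W : Op I O) : Prop :=
  ∀ M M' : ∀ k, Matrix (I k × O k) (I k × O k) ℂ,
    (∀ k ∈ K, IsCP (M k) ∧ M' k = M k) → (∀ k ∉ K, IsCPTP (M k) ∧ IsCPTP (M' k)) →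
      born W M = born W M'

/-- Process matrices compatible with party `k` acting first. -/
def IsCompatibleFirst (k : Fin N) (W : Op I O) : Prop :=
  IsProcess W ∧ NoSignallingTo {k} W

/-- Process matrices compatible with the fixed causal order `A_{π 0} ≺ A_{π 1} ≺ ⋯`: for every
`m`, the parties after position `m` cannot signal to the parties up to position `m`. -/
def IsCompatibleOrder (π : Equiv.Perm (Fin N)) (W : Op I O) : Prop :=
  IsProcess W ∧ ∀ m : Fin N, NoSignallingTo {k | π.symm k ≤ m} W

end Correlations

/-- The conditional matrix `Tr_k[(M ⊗ 𝟙) W]` of the other parties, for the map `M` applied by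
party `k`. -/
def conditional {n : ℕ} {I : Fin (n + 1) → Type u} {O : Fin (n + 1) → Type v}
    [∀ k, Fintype (I k)] [∀ k, Fintype (O k)] (k : Fin (n + 1))
    (M : Matrix (I k × O k) (I k × O k) ℂ) (W : Op I O) :
    Op (fun j => I (k.succAbove j)) (fun j => O (k.succAbove j)) :=
  Matrix.of fun a b =>
    ∑ x, ∑ y, M x y * W (k.insertNth (α := fun l => I l × O l) y a)
      (k.insertNth (α := fun l => I l × O l) x b)

/-! ### Definitions of causal separability -/

/-- Oreshkov and Giarmatzi's causal separability of an `N`-partite process matrix, by recursion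
on `N` (the case `N = 0` is only there to make the recursion total). -/
def IsOGSeparable : (N : ℕ) → (I : Fin N → Type u) → (O : Fin N → Type v) →
    [∀ k, Fintype (I k)] → [∀ k, Fintype (O k)] → [∀ k, DecidableEq (I k)] → Op I O → Prop
  | 0, _, _, _, _, _, W => IsProcess W
  | 1, _, _, _, _, _, W => IsProcess W
  | n + 2, I, O, _, _, _, W =>
    IsProcess W ∧
      ∃ (q : Fin (n + 2) → ℝ) (V : Fin (n + 2) → Op I O),
        (∀ k, 0 ≤ q k) ∧ ∑ k, q k = 1 ∧ W = ∑ k, (q k : ℂ) • V k ∧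
        ∀ k, IsCompatibleFirst k (V k) ∧
          ∀ M : Matrix (I k × O k) (I k × O k) ℂ, IsCP M →
            IsOGSeparable (n + 1) (fun j => I (k.succAbove j)) (fun j => O (k.succAbove j))
              (conditional k M (V k))

/-- A (normalised) quantum state. -/
def IsState {X : Type u} [Fintype X] (ρ : Matrix X X ℂ) : Prop :=
  ρ.PosSemidef ∧ ρ.trace = 1

/-- The extension `W ⊗ ρ`, where the state `ρ` lives in extra incoming spaces `I'` of the
parties. -/
def extend {N : ℕ} {I : Fin N → Type u} {O : Fin N → Type v} {I' : Fin N → Type}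
    (W : Op I O) (ρ : Matrix (∀ k, I' k) (∀ k, I' k) ℂ) : Op (fun k => I k × I' k) O :=
  Matrix.of fun i j =>
    W (fun k => ((i k).1.1, (i k).2)) (fun k => ((j k).1.1, (j k).2)) *
      ρ (fun k => (i k).1.2) (fun k => (j k).1.2)

/-- Oreshkov and Giarmatzi's extensible causal separability: causal separability of `W` and of
`W ⊗ ρ` for all extra incoming spaces (of arbitrary dimensions `d k`) and all states `ρ`. -/
def IsExtensiblyOGSeparable {N : ℕ} {I : Fin N → Type u} {O : Fin N → Type v}
    [∀ k, Fintype (I k)] [∀ k, Fintype (O k)] [∀ k, DecidableEq (I k)] (W : Op I O) : Prop :=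
  IsOGSeparable N I O W ∧
    ∀ (d : Fin N → ℕ) (ρ : Matrix (∀ k, Fin (d k)) (∀ k, Fin (d k)) ℂ), IsState ρ →
      IsOGSeparable N (fun k => I k × Fin (d k)) O (extend W ρ)

/-- Araújo et al.'s causal separability, for the parties `A = 0`, `B = 1`, `C = 2` (where `C` is
meant to have no outgoing system): the process matrix `W` is a convex combination of process
matrices compatible with the orders `A ≺ B ≺ C` and `B ≺ A ≺ C`. -/
def IsAraujoSeparable {I : Fin 3 → Type u} {O : Fin 3 → Type v}
    [∀ k, Fintype (I k)] [∀ k, Fintype (O k)] [∀ k, DecidableEq (I k)] (W : Op I O) : Prop :=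
  IsProcess W ∧
    ∃ (q : ℝ) (V V' : Op I O), 0 ≤ q ∧ q ≤ 1 ∧
      IsCompatibleOrder 1 V ∧ IsCompatibleOrder (Equiv.swap 0 1) V' ∧
      W = (q : ℂ) • V + ((1 - q : ℝ) : ℂ) • V'

/-- A witness of causal nonseparability, in the same scenario: a Hermitian `S` with
`Tr[S W] ≥ 0` for all causally separable `W`. -/
def IsCausalWitness {I : Fin 3 → Type u} {O : Fin 3 → Type v}
    [∀ k, Fintype (I k)] [∀ k, Fintype (O k)] [∀ k, DecidableEq (I k)] (S : Op I O) : Prop :=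
  S.IsHermitian ∧ ∀ W : Op I O, IsAraujoSeparable W → 0 ≤ (S * W).trace

/-! ### The explicit process matrix and witness -/

/-- All incoming systems are qubits. -/
abbrev QI : Fin 3 → Type := fun _ => Fin 2

/-- The outgoing systems of `A` and `B` are qubits, that of `C` is trivial. -/
abbrev QO : Fin 3 → Type := fun k => Fin (![2, 2, 1] k)

instance : Unique (QO 2) := inferInstanceAs (Unique (Fin 1))

/-- The basis of the outgoing system of `A`, as `Fin 2`. -/
def outA : QO 0 ≃ Fin 2 := Equiv.refl (Fin 2)

/-- The basis of the outgoing system of `B`, as `Fin 2`. -/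
def outB : QO 1 ≃ Fin 2 := Equiv.refl (Fin 2)

/-- The Pauli matrix `X`. -/
def σX : Matrix (Fin 2) (Fin 2) ℂ := !![0, 1; 1, 0]

/-- The Pauli matrix `Y`. -/
def σY : Matrix (Fin 2) (Fin 2) ℂ := !![0, -Complex.I; Complex.I, 0]

/-- The Pauli matrix `Z`. -/
def σZ : Matrix (Fin 2) (Fin 2) ℂ := !![1, 0; 0, -1]

/-- The `2 × 2` identity matrix. -/
def id2 : Matrix (Fin 2) (Fin 2) ℂ := 1

/-- `place c P Q` is the operator acting as `c` on `C_I`, as `P` on `A_I ⊗ B_I`, and as `Q` on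
`A_O ⊗ B_O`. -/
def place (c : Matrix (Fin 2) (Fin 2) ℂ)
    (P Q : Matrix (Fin 2 × Fin 2) (Fin 2 × Fin 2) ℂ) : Op QI QO :=
  Matrix.of fun i j =>
    c (i 2).1 (j 2).1 * P ((i 0).1, (i 1).1) ((j 0).1, (j 1).1) *
      Q (outA (i 0).2, outB (i 1).2) (outA (j 0).2, outB (j 1).2)

/-- The process matrix `W^act`. -/
noncomputable def Wact : Op QI QO :=
  (1 / 8 : ℂ) •
    (place id2 (id2 ⊗ₖ id2 - σZ ⊗ₖ σZ) (id2 ⊗ₖ id2)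
      + ((√3 / 4 : ℝ) : ℂ) • place id2 (σX ⊗ₖ σX + σY ⊗ₖ σY) (σZ ⊗ₖ id2 + id2 ⊗ₖ σZ)
      + (1 / 2 : ℂ) • place σZ (σZ ⊗ₖ id2 - id2 ⊗ₖ σZ) (id2 ⊗ₖ id2)
      + (1 / 4 : ℂ) • place σX (σX ⊗ₖ σY - σY ⊗ₖ σX) (σZ ⊗ₖ id2 - id2 ⊗ₖ σZ))

/-- The witness `S^act`. -/
noncomputable def Sact : Op QI QO :=
  (1 / 4 : ℂ) •
    (place id2 (id2 ⊗ₖ id2 - σZ ⊗ₖ σZ) (id2 ⊗ₖ id2 - σZ ⊗ₖ σZ)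
      - (2 / 3 : ℂ) • place id2 (σX ⊗ₖ σX + σY ⊗ₖ σY) (id2 ⊗ₖ σZ + σZ ⊗ₖ id2)
      + ((1 / √3 : ℝ) : ℂ) • place σZ (id2 ⊗ₖ σZ - σZ ⊗ₖ id2) (id2 ⊗ₖ id2 - σZ ⊗ₖ σZ)
      + ((1 / √3 : ℝ) : ℂ) • place σX (σX ⊗ₖ σY - σY ⊗ₖ σX) (id2 ⊗ₖ σZ - σZ ⊗ₖ id2)
      + (1 / 3 : ℂ) • place σY (σX ⊗ₖ σX + σY ⊗ₖ σY) (id2 ⊗ₖ σZ - σZ ⊗ₖ id2))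

end ProcMat

open ProcMat

namespace ProcMat

set_option linter.unusedSectionVars false

universe u v

open Matrix

/-! ### Positivity of contractions and of block-diagonal matrices -/

section PosSemidef

variable {ι α X Y : Type*}

/-! Since `C` has no outgoing system, its only CPTP map is the identity, and the order conditions
reduce to "`A` first" or "`B` first". As process matrices are not normalised, weights can be
absorbed, and Araújo separability becomes `W = V + V'` with `V` compatible with `A` first and `V'`
with `B` first (`isAraujoSeparable_iff`). Such a sum is OG-separable with zero term for `C`, and it
survives tensoring with any `ρ`, because `ρ` is a linear combination of product states, which local
operations absorb (`NoSignallingTo.extend`).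

The converse is teleportation. Let extra systems of `A` and `C` be maximally entangled, and
decompose `W ⊗ ρ` in the OG sense. In the term with `C` first, a Bell measurement by `C` leaves, for
each outcome, a sum of an `A`-first and a `B`-first operator, with the state of `C_I` moved to the
extra system of `A` up to a known unitary. Undoing that unitary and renaming the system as `C_I`
preserves both kinds of compatibility. Summed over outcomes, this linear map returns a multiple of
`W` (`teleportSum_extend`), and it also preserves compatibility for the terms that already have `A`
or `B` first, so `W` is a sum of the required form.

For the example, everything is block diagonal in the outgoing bases and, up to a correction of the
witness, lives on the antiparallel subspace of `A_I ⊗ B_I`, so positivity is a question about small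
blocks. `Wact` has `C` first, and each operation of `C` leaves an `A`-first and a `B`-first half
(`conditional_Wact`, `halfAct_posSemidef`). The witness becomes positive after adding a term that
vanishes on `A`-first operators, and also after adding another that vanishes on `B`-first ones
(`blockS_posSemidef`, `trace_place_mul_of_first_A`, `trace_place_mul_of_first_B`). -/

theorem posSemidef_sum_blocks [Fintype X] [Fintype α] {H : Matrix (X × α) (X × α) ℂ}
    (hH : H.PosSemidef) : (Matrix.of fun a b => ∑ x, ∑ y, H (x, a) (y, b)).PosSemidef := by
  classical
  have h := hH.conjTranspose_mul_mul_same (Matrix.of fun (i : X × α) (b : α) =>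
    if i.2 = b then (1 : ℂ) else 0)
  convert h using 1
  ext a b
  simp only [Matrix.of_apply, Matrix.mul_apply, Matrix.conjTranspose_apply, apply_ite star,
    star_one, star_zero, ite_mul, mul_ite, one_mul, zero_mul, mul_one, mul_zero,
    Fintype.sum_prod_type, Finset.sum_ite_eq', Finset.mem_univ, if_true]
  exact Finset.sum_comm

/-- By the Schur product theorem the entrywise product of `Mᵀ` and `W` is positive, and a sum over
blocks is a compression. This covers both conditioning on an operation and feeding in a state. -/
theorem posSemidef_contract [Fintype X] [Fintype α] {M : Matrix X X ℂ} {W : Matrix ι ι ℂ}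
    (hM : M.PosSemidef) (hW : W.PosSemidef) (f : X → α → ι) :
    (Matrix.of fun a b => ∑ x, ∑ y, M x y * W (f y a) (f x b)).PosSemidef := by
  have h := posSemidef_sum_blocks
    ((hM.transpose.submatrix Prod.fst).hadamard (hW.submatrix fun i : X × α => f i.1 i.2))
  convert h using 1
  ext a b
  simp only [Matrix.of_apply, Matrix.hadamard_apply, Matrix.submatrix_apply,
    Matrix.transpose_apply]
  exact Finset.sum_comm

/-- A matrix that is block diagonal, with positive semidefinite blocks, is positive
semidefinite. -/
theorem posSemidef_blockDiag [Fintype ι] [Fintype Y] [DecidableEq Y] (R : Y → Matrix X X ℂ)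
    (hR : ∀ y, (R y).PosSemidef) (f : ι → X) (g : ι → Y) (p : ι → Prop) [DecidablePred p] :
    (Matrix.of fun i j =>
      if g i = g j ∧ p i ∧ p j then R (g i) (f i) (f j) else 0).PosSemidef := by
  classical
  have h : (∑ y, (Matrix.diagonal fun i => if g i = y ∧ p i then (1 : ℂ) else 0) *
      (R y).submatrix f f * (Matrix.diagonal fun i => if g i = y ∧ p i then (1 : ℂ) else 0)ᴴ
      ).PosSemidef :=
    Matrix.posSemidef_sum _ fun y _ => ((hR y).submatrix f).mul_mul_conjTranspose_same _
  convert h using 1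
  ext i j
  simp only [Matrix.sum_apply, Matrix.diagonal_conjTranspose, Matrix.mul_diagonal,
    Matrix.diagonal_mul, Matrix.submatrix_apply, Matrix.of_apply, Pi.star_apply]
  rw [Finset.sum_eq_single (g i)]
  · by_cases h1 : g i = g j <;> by_cases h2 : p i <;> by_cases h3 : p j <;>
      simp [h1, h2, h3, eq_comm]
  · intro y _ hy
    simp [hy.symm]
  · simp

end PosSemidef

/-! ### Linearity of the Born rule; cones of process matrices -/

section General

variable {N : ℕ} {I : Fin N → Type u} {O : Fin N → Type v}
  [∀ k, Fintype (I k)] [∀ k, Fintype (O k)]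

theorem born_eq_sum (W : Op I O) (M : ∀ k, Matrix (I k × O k) (I k × O k) ℂ) :
    born W M = ∑ i, ∑ j, (∏ k, M k (i k) (j k)) * W j i := by
  simp [born, Matrix.trace, Matrix.mul_apply, tensor]

theorem born_add (W W' : Op I O) (M : ∀ k, Matrix (I k × O k) (I k × O k) ℂ) :
    born (W + W') M = born W M + born W' M := by
  simp [born, Matrix.mul_add]

theorem born_sub (W W' : Op I O) (M : ∀ k, Matrix (I k × O k) (I k × O k) ℂ) :
    born (W - W') M = born W M - born W' M := by
  simp [born, Matrix.mul_sub]

theorem born_smul (c : ℂ) (W : Op I O) (M : ∀ k, Matrix (I k × O k) (I k × O k) ℂ) :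
    born (c • W) M = c * born W M := by
  simp [born]

theorem born_zero (M : ∀ k, Matrix (I k × O k) (I k × O k) ℂ) :
    born (0 : Op I O) M = 0 := by
  simp [born]

theorem born_sum {ι : Type*} (s : Finset ι) (W : ι → Op I O)
    (M : ∀ k, Matrix (I k × O k) (I k × O k) ℂ) :
    born (∑ a ∈ s, W a) M = ∑ a ∈ s, born (W a) M := by
  simp [born, Matrix.mul_sum, Matrix.trace_sum]

theorem trace_tensor_mul_tensor (M M' : ∀ k, Matrix (I k × O k) (I k × O k) ℂ) :
    (tensor M * tensor M').trace = ∏ k, (M k * M' k).trace := by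
  classical
  simp only [Matrix.trace, Matrix.diag, Matrix.mul_apply, tensor, Matrix.of_apply,
    ← Finset.prod_mul_distrib]
  rw [Finset.prod_univ_sum, Fintype.piFinset_univ]
  refine Finset.sum_congr rfl fun i _ => ?_
  rw [Finset.prod_univ_sum, Fintype.piFinset_univ]

theorem IsCPTP.isCP {X : Type u} {Y : Type v} [DecidableEq X] [Fintype Y]
    {M : Matrix (X × Y) (X × Y) ℂ} (h : IsCPTP M) : IsCP M := h.1

/-- With a trivial outgoing system, the identity is the only trace-preserving map. -/
theorem IsCPTP.eq_one {X : Type u} {Y : Type v} [DecidableEq X] [DecidableEq Y] [Fintype Y]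
    [Unique Y] {M : Matrix (X × Y) (X × Y) ℂ} (h : IsCPTP M) : M = 1 := by
  ext ⟨x, y⟩ ⟨x', y'⟩
  have := h.2 x x'
  rw [Fintype.sum_unique] at this
  rw [Unique.eq_default y, Unique.eq_default y', this]
  simp [Matrix.one_apply]

theorem IsCPTP.unique {X : Type u} {Y : Type v} [DecidableEq X] [Fintype Y]
    [Unique Y] {M M' : Matrix (X × Y) (X × Y) ℂ} (h : IsCPTP M) (h' : IsCPTP M') : M = M' := by
  classical
  rw [h.eq_one, h'.eq_one]

theorem isCPTP_one {X : Type u} {Y : Type v} [Fintype X] [DecidableEq X] [DecidableEq Y]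
    [Fintype Y] [Unique Y] : IsCPTP (1 : Matrix (X × Y) (X × Y) ℂ) := by
  refine ⟨Matrix.PosSemidef.one, fun x x' => ?_⟩
  rw [Fintype.sum_unique]
  simp [Matrix.one_apply]

variable [∀ k, DecidableEq (I k)]

theorem NoSignallingTo.zero (K : Set (Fin N)) : NoSignallingTo K (0 : Op I O) := by
  intro M M' _ _
  simp [born_zero]

theorem NoSignallingTo.add {K : Set (Fin N)} {W W' : Op I O} (h : NoSignallingTo K W)
    (h' : NoSignallingTo K W') : NoSignallingTo K (W + W') := by
  intro M M' h1 h2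
  rw [born_add, born_add, h M M' h1 h2, h' M M' h1 h2]

theorem NoSignallingTo.smul {K : Set (Fin N)} {W : Op I O} (h : NoSignallingTo K W) (c : ℂ) :
    NoSignallingTo K (c • W) := by
  intro M M' h1 h2
  rw [born_smul, born_smul, h M M' h1 h2]

theorem isProcess_iff {W : Op I O} : IsProcess W ↔ W.PosSemidef ∧ NoSignallingTo ∅ W := by
  refine and_congr_right fun _ => ⟨fun h M M' _ h2 => ?_, fun h M M' h1 h2 => ?_⟩
  · exact h M M' (fun k => (h2 k (by simp)).1) (fun k => (h2 k (by simp)).2)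
  · exact h M M' (by simp) (fun k _ => ⟨h1 k, h2 k⟩)

theorem IsProcess.zero : IsProcess (0 : Op I O) :=
  isProcess_iff.2 ⟨Matrix.PosSemidef.zero, NoSignallingTo.zero _⟩

theorem IsProcess.add {W W' : Op I O} (h : IsProcess W) (h' : IsProcess W') :
    IsProcess (W + W') :=
  isProcess_iff.2 ⟨h.1.add h'.1, (isProcess_iff.1 h).2.add (isProcess_iff.1 h').2⟩

theorem IsProcess.smul {W : Op I O} (h : IsProcess W) {c : ℂ} (hc : 0 ≤ c) :
    IsProcess (c • W) :=
  isProcess_iff.2 ⟨h.1.smul hc, (isProcess_iff.1 h).2.smul c⟩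

theorem IsCompatibleFirst.zero (k : Fin N) : IsCompatibleFirst k (0 : Op I O) :=
  ⟨IsProcess.zero, NoSignallingTo.zero _⟩

theorem IsCompatibleFirst.add {k : Fin N} {W W' : Op I O} (h : IsCompatibleFirst k W)
    (h' : IsCompatibleFirst k W') : IsCompatibleFirst k (W + W') :=
  ⟨h.1.add h'.1, h.2.add h'.2⟩

theorem IsCompatibleFirst.smul {k : Fin N} {W : Op I O} (h : IsCompatibleFirst k W) {c : ℂ}
    (hc : 0 ≤ c) : IsCompatibleFirst k (c • W) :=
  ⟨h.1.smul hc, h.2.smul c⟩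

theorem IsCompatibleFirst.sum {ι : Type*} {k : Fin N} (s : Finset ι) {W : ι → Op I O}
    (h : ∀ a ∈ s, IsCompatibleFirst k (W a)) : IsCompatibleFirst k (∑ a ∈ s, W a) := by
  classical
  induction s using Finset.induction_on with
  | empty => simpa using IsCompatibleFirst.zero k
  | insert a s ha ih =>
    rw [Finset.sum_insert ha]
    exact (h a (by simp)).add (ih fun b hb => h b (by simp [hb]))

/-- For a positive operator, compatibility with `k` acting first only needs the no-signalling
condition. -/
theorem isCompatibleFirst_of_noSignallingTo {k : Fin N} {W : Op I O} (hW : W.PosSemidef)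
    (h : ∀ M M' : ∀ l, Matrix (I l × O l) (I l × O l) ℂ, IsCPTP (M k) → IsCPTP (M' k) →
      (∀ l, l ≠ k → IsCPTP (M l) ∧ IsCPTP (M' l)) → born W M = born W M')
    (h' : NoSignallingTo {k} W) : IsCompatibleFirst k W :=
  ⟨⟨hW, fun M M' h1 h2 => h M M' (h1 k) (h2 k) fun l _ => ⟨h1 l, h2 l⟩⟩, h'⟩

end General

/-! ### Conditioning on one party's operation -/

section Conditional

variable {n : ℕ} {I : Fin (n + 1) → Type u} {O : Fin (n + 1) → Type v}
  [∀ k, Fintype (I k)] [∀ k, Fintype (O k)]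

theorem born_conditional (k : Fin (n + 1)) (W : Op I O)
    (M : ∀ l, Matrix (I l × O l) (I l × O l) ℂ) :
    born (conditional k (M k) W) (fun j => M (k.succAbove j)) = born W M := by
  rw [born_eq_sum, born_eq_sum]
  have e1 : ∀ f : Sys I O → ℂ, ∑ i, f i =
      ∑ x, ∑ a, f (k.insertNth (α := fun l => I l × O l) x a) := by
    intro f
    rw [← (Fin.insertNthEquiv (fun l => I l × O l) k).sum_comp, Fintype.sum_prod_type]
    rfl
  simp only [e1, Fin.prod_univ_succAbove _ k, Fin.insertNth_apply_same,
    Fin.insertNth_apply_succAbove, conditional, Matrix.of_apply, Finset.mul_sum]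
  rw [Finset.sum_comm (f := fun x a => ∑ y, ∑ b, M k x y * _ * _)]
  refine Finset.sum_congr rfl fun a _ => ?_
  rw [Finset.sum_comm]
  refine Finset.sum_congr rfl fun x _ => ?_
  rw [Finset.sum_comm]
  exact Finset.sum_congr rfl fun y _ => Finset.sum_congr rfl fun b _ => by ring

theorem conditional_posSemidef (k : Fin (n + 1)) {M : Matrix (I k × O k) (I k × O k) ℂ}
    {W : Op I O} (hM : IsCP M) (hW : W.PosSemidef) : (conditional k M W).PosSemidef :=
  posSemidef_contract hM hW fun y a => k.insertNth (α := fun l => I l × O l) y a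

/-- Moving a scalar into the operation is what lets weights be absorbed: conditions quantified over
all CP maps are insensitive to positive rescaling. -/
theorem conditional_smul (k : Fin (n + 1)) (M : Matrix (I k × O k) (I k × O k) ℂ)
    (c : ℂ) (W : Op I O) : conditional k M (c • W) = conditional k (c • M) W := by
  ext a b
  simp only [conditional, Matrix.of_apply, Matrix.smul_apply, smul_eq_mul]
  exact Finset.sum_congr rfl fun x _ => Finset.sum_congr rfl fun y _ => by ring

theorem conditional_smul_left (k : Fin (n + 1)) (M : Matrix (I k × O k) (I k × O k) ℂ)
    (c : ℂ) (W : Op I O) : conditional k (c • M) W = c • conditional k M W := by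
  ext a b
  simp only [conditional, Matrix.of_apply, Matrix.smul_apply, smul_eq_mul, Finset.mul_sum]
  exact Finset.sum_congr rfl fun x _ => Finset.sum_congr rfl fun y _ => by ring

theorem conditional_add (k : Fin (n + 1)) (M : Matrix (I k × O k) (I k × O k) ℂ)
    (W W' : Op I O) : conditional k M (W + W') = conditional k M W + conditional k M W' := by
  ext a b
  simp [conditional, mul_add, Finset.sum_add_distrib]

theorem conditional_zero (k : Fin (n + 1)) (M : Matrix (I k × O k) (I k × O k) ℂ) :
    conditional k M (0 : Op I O) = 0 := by
  ext a b
  simp [conditional]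

variable [∀ k, DecidableEq (I k)]

/-- With `M` inserted at `k`, no signalling to `k` says precisely that the remaining total
probability is independent of the other parties' CPTP maps. -/
theorem IsCompatibleFirst.isProcess_conditional {k : Fin (n + 1)} {W : Op I O}
    (h : IsCompatibleFirst k W) {M : Matrix (I k × O k) (I k × O k) ℂ} (hM : IsCP M) :
    IsProcess (conditional k M W) := by
  refine ⟨conditional_posSemidef k hM h.1.1, fun L L' hL hL' => ?_⟩
  have e := h.2 (k.insertNth (α := fun l => Matrix (I l × O l) (I l × O l) ℂ) M L)
    (k.insertNth (α := fun l => Matrix (I l × O l) (I l × O l) ℂ) M L')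
    (by simpa using hM)
    (by
      intro l hl
      obtain ⟨j, rfl⟩ := Fin.exists_succAbove_eq hl
      simpa using ⟨hL j, hL' j⟩)
  rw [← born_conditional k, ← born_conditional k] at e
  simpa using e

end Conditional

/-! ### Oreshkov–Giarmatzi separability without weights -/

section OGSeparable

theorem isOGSeparable_succ_succ {n : ℕ} {I : Fin (n + 2) → Type u} {O : Fin (n + 2) → Type v}
    [∀ k, Fintype (I k)] [∀ k, Fintype (O k)] [∀ k, DecidableEq (I k)] {W : Op I O} :
    IsOGSeparable (n + 2) I O W ↔ IsProcess W ∧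
      ∃ (q : Fin (n + 2) → ℝ) (V : Fin (n + 2) → Op I O),
        (∀ k, 0 ≤ q k) ∧ ∑ k, q k = 1 ∧ W = ∑ k, (q k : ℂ) • V k ∧
        ∀ k, IsCompatibleFirst k (V k) ∧
          ∀ M : Matrix (I k × O k) (I k × O k) ℂ, IsCP M →
            IsOGSeparable (n + 1) (fun j => I (k.succAbove j)) (fun j => O (k.succAbove j))
              (conditional k M (V k)) :=
  Iff.rfl

/-- The weights in the definition of causal separability can be absorbed into the terms. -/
theorem isOGSeparable_sum {n : ℕ} {I : Fin (n + 2) → Type u} {O : Fin (n + 2) → Type v}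
    [∀ k, Fintype (I k)] [∀ k, Fintype (O k)] [∀ k, DecidableEq (I k)]
    {V : Fin (n + 2) → Op I O} (hW : IsProcess (∑ k, V k))
    (hV : ∀ k, IsCompatibleFirst k (V k))
    (hV' : ∀ k, ∀ M : Matrix (I k × O k) (I k × O k) ℂ, IsCP M →
      IsOGSeparable (n + 1) (fun j => I (k.succAbove j)) (fun j => O (k.succAbove j))
        (conditional k M (V k))) :
    IsOGSeparable (n + 2) I O (∑ k, V k) := by
  have hn : (0 : ℂ) ≤ ((n + 2 : ℕ) : ℂ) := Nat.cast_nonneg _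
  -- Uniform weights are compensated by rescaling every term by `n + 2`; the same factor is then
  -- moved into the CP map of the conditional.
  refine isOGSeparable_succ_succ.2 ⟨hW, fun _ => ((n + 2 : ℕ) : ℝ)⁻¹,
    fun k => ((n + 2 : ℕ) : ℂ) • V k, fun k => by positivity, ?_, ?_, fun k =>
    ⟨(hV k).smul hn, fun M hM => ?_⟩⟩
  · rw [Finset.sum_const, Finset.card_univ, Fintype.card_fin, nsmul_eq_mul]
    exact mul_inv_cancel₀ (by positivity)
  · refine Finset.sum_congr rfl fun k _ => ?_
    rw [smul_smul, Complex.ofReal_inv, Complex.ofReal_natCast, inv_mul_cancel₀, one_smul]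
    exact Nat.cast_ne_zero.2 (by omega)
  · rw [conditional_smul]
    exact hV' k _ (hM.smul hn)

theorem isOGSeparable_zero : ∀ (N : ℕ) (I : Fin N → Type u) (O : Fin N → Type v)
    [∀ k, Fintype (I k)] [∀ k, Fintype (O k)] [∀ k, DecidableEq (I k)],
    IsOGSeparable N I O 0
  | 0, _, _, _, _, _ => IsProcess.zero
  | 1, _, _, _, _, _ => IsProcess.zero
  | n + 2, I, O, _, _, _ => by
    have := isOGSeparable_sum (n := n) (I := I) (O := O) (V := fun _ => 0)
      (by simpa using IsProcess.zero) (fun k => IsCompatibleFirst.zero k) fun k M _ => by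
        rw [conditional_zero]; exact isOGSeparable_zero (n + 1) _ _
    simpa using this

/-- For one remaining party separability only asks for a process matrix, which compatibility already
guarantees for the conditionals. -/
theorem isOGSeparable_two {I : Fin 2 → Type u} {O : Fin 2 → Type v}
    [∀ k, Fintype (I k)] [∀ k, Fintype (O k)] [∀ k, DecidableEq (I k)] {U U' : Op I O}
    (hU : IsCompatibleFirst 0 U) (hU' : IsCompatibleFirst 1 U') :
    IsOGSeparable 2 I O (U + U') := by
  have hV : ∀ k : Fin 2, IsCompatibleFirst k ((![U, U'] : Fin 2 → Op I O) k) := by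
    intro k; fin_cases k
    exacts [hU, hU']
  have := isOGSeparable_sum (n := 0) (I := I) (O := O) (V := ![U, U'])
    (by simpa using hU.1.add hU'.1) hV
    fun k M hM => (hV k).isProcess_conditional hM
  simpa using this

end OGSeparable

/-! ### Extra incoming systems in a shared state -/

section Extension

variable {N : ℕ} {I : Fin N → Type u} {O : Fin N → Type v} {I' : Fin N → Type}
  [∀ k, Fintype (I k)] [∀ k, Fintype (O k)] [∀ k, Fintype (I' k)]

/-- Basis of the extended systems, as pairs of a basis element of the extra incoming systems and
one of the original systems. -/
def extendEquiv (I : Fin N → Type u) (O : Fin N → Type v) (I' : Fin N → Type) :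
    (∀ k, I' k) × Sys I O ≃ Sys (fun k => I k × I' k) O where
  toFun p k := (((p.2 k).1, p.1 k), (p.2 k).2)
  invFun i := (fun k => (i k).1.2, fun k => ((i k).1.1, (i k).2))
  left_inv _ := rfl
  right_inv _ := rfl

theorem extend_extendEquiv (W : Op I O) (ρ : Matrix (∀ k, I' k) (∀ k, I' k) ℂ)
    (p q : (∀ k, I' k) × Sys I O) :
    extend W ρ (extendEquiv I O I' p) (extendEquiv I O I' q) = W p.2 q.2 * ρ p.1 q.1 := rfl

theorem extend_posSemidef {W : Op I O} {ρ : Matrix (∀ k, I' k) (∀ k, I' k) ℂ}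
    (hW : W.PosSemidef) (hρ : ρ.PosSemidef) : (extend W ρ).PosSemidef :=
  (hW.submatrix fun i : Sys (fun k => I k × I' k) O => fun k => ((i k).1.1, (i k).2)).hadamard
    (hρ.submatrix fun i : Sys (fun k => I k × I' k) O => fun k => (i k).1.2)

/-- The local operation obtained by feeding the state `R` into the extra incoming system. -/
def absorb {A : Type u} {B : Type v} {X : Type} [Fintype X]
    (M : Matrix ((A × X) × B) ((A × X) × B) ℂ) (R : Matrix X X ℂ) :
    Matrix (A × B) (A × B) ℂ :=
  Matrix.of fun a b => ∑ x, ∑ y, R x y * M ((a.1, y), a.2) ((b.1, x), b.2)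

theorem IsCP.absorb {A : Type u} {B : Type v} {X : Type} [Fintype X] [Fintype A] [Fintype B]
    {M : Matrix ((A × X) × B) ((A × X) × B) ℂ} {R : Matrix X X ℂ} (hM : IsCP M)
    (hR : IsState R) : IsCP (absorb M R) :=
  posSemidef_contract hR.1 hM fun x (a : A × B) => ((a.1, x), a.2)

theorem IsCPTP.absorb {A : Type u} {B : Type v} {X : Type} [Fintype X] [Fintype A] [Fintype B]
    [DecidableEq A] [DecidableEq X]
    {M : Matrix ((A × X) × B) ((A × X) × B) ℂ} {R : Matrix X X ℂ} (hM : IsCPTP M)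
    (hR : IsState R) : IsCPTP (absorb M R) := by
  refine ⟨hM.isCP.absorb hR, fun a a' => ?_⟩
  simp only [ProcMat.absorb, Matrix.of_apply]
  rw [Finset.sum_comm]
  simp_rw [Finset.sum_comm (s := (Finset.univ : Finset B)), ← Finset.mul_sum, hM.2]
  have := hR.2
  simp only [Matrix.trace, Matrix.diag] at this
  by_cases h : a = a' <;> simp [Matrix.one_apply, h, this]

/-- Each factor of a product state meets only its own party's map, so the extension is equivalent to
changing the local operations. -/
theorem born_extend_prod (W : Op I O) (R : ∀ k, Matrix (I' k) (I' k) ℂ)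
    (M : ∀ k, Matrix ((I k × I' k) × O k) ((I k × I' k) × O k) ℂ) :
    born (extend W (Matrix.of fun x y => ∏ k, R k (x k) (y k))) M =
      born W fun k => absorb (M k) (R k) := by
  classical
  rw [born_eq_sum, born_eq_sum]
  simp only [← (extendEquiv I O I').sum_comp, extend_extendEquiv, Fintype.sum_prod_type,
    ProcMat.absorb, Matrix.of_apply]
  simp only [Finset.prod_univ_sum, Fintype.piFinset_univ, Finset.sum_mul]
  rw [Finset.sum_comm]
  refine Finset.sum_congr rfl fun i _ => ?_
  have e : ∀ F : Sys I O → (∀ k, I' k) → (∀ k, I' k) → ℂ,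
      ∑ j, ∑ x, ∑ y, F j x y = ∑ y, ∑ x, ∑ j, F j x y := by
    intro F
    rw [Finset.sum_comm]
    simp_rw [Finset.sum_comm (f := fun j y => F j _ y)]
    rw [Finset.sum_comm]
  rw [e]
  refine Finset.sum_congr rfl fun x _ => Finset.sum_congr rfl fun y _ =>
    Finset.sum_congr rfl fun j _ => ?_
  rw [Finset.prod_mul_distrib]
  simp only [extendEquiv, Equiv.coe_fn_mk]
  ring

/-- Polarisation: states span all matrices over `ℂ`, with a uniform number of terms so that the
expansions for all parties share one index type. -/
theorem exists_single_eq_sum_states {X : Type} [Fintype X] [DecidableEq X] (i j : X) :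
    ∃ (c : Fin 4 → ℂ) (S : Fin 4 → Matrix X X ℂ), (∀ l, IsState (S l)) ∧
      Matrix.single i j 1 = ∑ l, c l • S l := by
  have hs : ∀ i : X, IsState (Matrix.single i i (1 : ℂ)) := fun i => by
    refine ⟨?_, by simp⟩
    rw [← Matrix.diagonal_single]
    exact Matrix.PosSemidef.diagonal (by rw [Pi.single_nonneg]; exact zero_le_one)
  by_cases hij : i = j
  · subst hij
    exact ⟨![1, 0, 0, 0], fun _ => Matrix.single i i 1, fun _ => hs i, by
      simp [Fin.sum_univ_four]⟩
  · have hji : ¬ j = i := fun h => hij h.symm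
    obtain ⟨T, hT⟩ : ∃ T : ℂ → Matrix X X ℂ, ∀ z, T z = (1 / 2 : ℂ) •
        Matrix.vecMulVec (Pi.single i 1 + Pi.single j z)
          (star (Pi.single i 1 + Pi.single j z)) := ⟨_, fun _ => rfl⟩
    have hv : ∀ z : ℂ, z * star z = 1 → IsState (T z) := by
      intro z hz
      rw [hT]
      refine ⟨(Matrix.posSemidef_vecMulVec_self_star _).smul
        (Complex.zero_le_real.2 (by norm_num : (0 : ℝ) ≤ 1 / 2) |>.trans_eq (by simp)), ?_⟩
      rw [Matrix.trace_smul, Matrix.trace_vecMulVec, star_add, ← Pi.single_star, ← Pi.single_star]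
      simp only [dotProduct_add, dotProduct_single, Pi.add_apply, Pi.single_eq_same,
        Pi.single_eq_of_ne hij, Pi.single_eq_of_ne hji, star_one]
      norm_num
      rw [mul_comm, ← Complex.star_def, hz]
      norm_num
    -- In `T 1 + I • T I` the `|j⟩⟨i|` parts cancel and the `|i⟩⟨j|` parts add up to one; the last
    -- two states remove the remaining diagonal `(1 + I) / 2`.
    refine ⟨![1, Complex.I, -(1 + Complex.I) / 2, -(1 + Complex.I) / 2],
      ![T 1, T Complex.I, Matrix.single i i 1, Matrix.single j j 1], ?_, ?_⟩
    · intro l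
      fin_cases l
      exacts [hv 1 (by simp), hv _ (by simp), hs i, hs j]
    · ext a b
      simp only [Fin.sum_univ_four, Matrix.add_apply, Matrix.smul_apply, Matrix.vecMulVec_apply,
        Matrix.single_apply, Pi.single_apply, Pi.add_apply, Pi.star_apply, smul_eq_mul,
        Matrix.cons_val, hT]
      by_cases h1 : a = i <;> by_cases h2 : b = i <;> by_cases h3 : a = j <;>
        by_cases h4 : b = j <;> simp_all [eq_comm] <;> ring_nf <;> simp <;> ring

variable [∀ k, DecidableEq (I k)] [∀ k, DecidableEq (I' k)]

/-- The condition is linear in `ρ`, so complex combinations of product states suffice and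
entanglement of `ρ` is no obstacle. Each product state is absorbed into the local maps, keeping them
CP or CPTP. -/
theorem NoSignallingTo.extend {K : Set (Fin N)} {W : Op I O} (h : NoSignallingTo K W)
    (ρ : Matrix (∀ k, I' k) (∀ k, I' k) ℂ) : NoSignallingTo K (extend W ρ) := by
  choose c S hS hc using fun k => exists_single_eq_sum_states (X := I' k)
  have key : ProcMat.extend W ρ = ∑ x, ∑ y, ∑ l : Fin N → Fin 4,
      (ρ x y * ∏ k, c k (x k) (y k) (l k)) •
        ProcMat.extend W (Matrix.of fun x' y' => ∏ k, S k (x k) (y k) (l k) (x' k) (y' k)) := by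
    ext i j
    simp only [Matrix.sum_apply, Matrix.smul_apply, ProcMat.extend, Matrix.of_apply, smul_eq_mul]
    have e : ∀ x y : ∀ k, I' k, ∑ l : Fin N → Fin 4,
        (∏ k, c k (x k) (y k) (l k)) * ∏ k, S k (x k) (y k) (l k) (i k).1.2 (j k).1.2 =
        if (x = fun k => (i k).1.2) ∧ (y = fun k => (j k).1.2) then 1 else 0 := by
      intro x y
      simp only [← Finset.prod_mul_distrib]
      rw [← Fintype.piFinset_univ, ← Finset.prod_univ_sum (fun _ => Finset.univ)
        (fun k l => c k (x k) (y k) l * S k (x k) (y k) l (i k).1.2 (j k).1.2)]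
      have e' : ∀ k, ∑ l, c k (x k) (y k) l * S k (x k) (y k) l (i k).1.2 (j k).1.2 =
          if x k = (i k).1.2 ∧ y k = (j k).1.2 then 1 else 0 := by
        intro k
        have := congrFun₂ (hc k (x k) (y k)) (i k).1.2 (j k).1.2
        simpa [Matrix.single_apply, Matrix.sum_apply] using this.symm
      simp_rw [e', Finset.prod_ite_zero]
      simp [funext_iff, forall_and]
    have e2 : ∀ x y : ∀ k, I' k, ∑ l : Fin N → Fin 4,
        (ρ x y * ∏ k, c k (x k) (y k) (l k)) *
          (W (fun k => ((i k).1.1, (i k).2)) (fun k => ((j k).1.1, (j k).2)) *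
            ∏ k, S k (x k) (y k) (l k) (i k).1.2 (j k).1.2) =
        W (fun k => ((i k).1.1, (i k).2)) (fun k => ((j k).1.1, (j k).2)) * (ρ x y *
          if (x = fun k => (i k).1.2) ∧ (y = fun k => (j k).1.2) then 1 else 0) := by
      intro x y
      rw [← e, Finset.mul_sum, Finset.mul_sum]
      exact Finset.sum_congr rfl fun l _ => by ring
    simp_rw [e2, ← Finset.mul_sum, ite_and]
    simp
  intro M M' h1 h2
  simp only [key, born_sum, born_smul, born_extend_prod]
  refine Finset.sum_congr rfl fun x _ => Finset.sum_congr rfl fun y _ =>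
    Finset.sum_congr rfl fun l _ => congrArg _ (h _ _ ?_ ?_)
  · intro k hk
    exact ⟨(h1 k hk).1.absorb (hS k _ _ _), by rw [(h1 k hk).2]⟩
  · intro k hk
    exact ⟨(h2 k hk).1.absorb (hS k _ _ _), (h2 k hk).2.absorb (hS k _ _ _)⟩

theorem IsProcess.extend {W : Op I O} (h : IsProcess W)
    {ρ : Matrix (∀ k, I' k) (∀ k, I' k) ℂ} (hρ : ρ.PosSemidef) : IsProcess (extend W ρ) :=
  isProcess_iff.2 ⟨extend_posSemidef h.1 hρ, (isProcess_iff.1 h).2.extend ρ⟩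

theorem IsCompatibleFirst.extend {k : Fin N} {W : Op I O} (h : IsCompatibleFirst k W)
    {ρ : Matrix (∀ k, I' k) (∀ k, I' k) ℂ} (hρ : ρ.PosSemidef) :
    IsCompatibleFirst k (extend W ρ) :=
  ⟨h.1.extend hρ, h.2.extend ρ⟩

end Extension

/-! ### Three parties, the last without outgoing system -/

section Tripartite

variable {I : Fin 3 → Type u} {O : Fin 3 → Type v}
  [∀ k, Fintype (I k)] [∀ k, Fintype (O k)] [∀ k, DecidableEq (I k)] [Unique (O 2)]

/-- If the last party has no outgoing system, compatibility with an order that ends with it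
amounts to compatibility with the first party of the order acting first. -/
theorem isCompatibleOrder_iff {π : Equiv.Perm (Fin 3)} (hπ : π 2 = 2) {W : Op I O} :
    IsCompatibleOrder π W ↔ IsCompatibleFirst (π 0) W := by
  have h0 : {k | π.symm k ≤ 0} = {π 0} := by
    ext k
    simp [Equiv.symm_apply_eq]
  refine and_congr_right fun hW => ⟨fun h => h0 ▸ h 0, fun h m => ?_⟩
  by_cases hm : m = 0
  · rw [hm, h0]
    exact h
  · intro M M' h1 h2
    -- For `m ≠ 0` only party 2 can lie outside the set, and its CPTP map is unique, so the
    -- condition is vacuous.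
    have : M = M' := by
      funext k
      by_cases hk : π.symm k ≤ m
      · exact ((h1 k hk).2).symm
      · have hk2 : k = 2 := by
          have : π.symm k = 2 := by omega
          rw [← hπ, ← this, Equiv.apply_symm_apply]
        subst hk2
        exact (h2 2 hk).1.unique (h2 2 hk).2
    rw [this]

theorem isAraujoSeparable_iff {W : Op I O} :
    IsAraujoSeparable W ↔ ∃ V V', IsCompatibleFirst 0 V ∧ IsCompatibleFirst 1 V' ∧ W = V + V' := by
  constructor
  · rintro ⟨-, q, V, V', h0, h1, hV, hV', rfl⟩
    rw [isCompatibleOrder_iff rfl] at hV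
    rw [isCompatibleOrder_iff (by decide)] at hV'
    exact ⟨_, _, hV.smul (Complex.zero_le_real.2 h0),
      hV'.smul (Complex.zero_le_real.2 (sub_nonneg.2 h1)), rfl⟩
  · rintro ⟨V, V', hV, hV', rfl⟩
    refine ⟨hV.1.add hV'.1, 1 / 2, (2 : ℂ) • V, (2 : ℂ) • V', by norm_num, by norm_num,
      (isCompatibleOrder_iff rfl).2 (hV.smul (by norm_num)),
      (isCompatibleOrder_iff (by decide)).2 (hV'.smul (by norm_num)), ?_⟩
    norm_num [smul_smul]

theorem IsAraujoSeparable.isOGSeparable {W : Op I O} (h : IsAraujoSeparable W) :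
    IsOGSeparable 3 I O W := by
  obtain ⟨V, V', hV, hV', hW⟩ := isAraujoSeparable_iff.1 h
  have e : W = ∑ k, (![V, V', 0] : Fin 3 → Op I O) k := by simp [hW, Fin.sum_univ_three]
  have hU : ∀ k : Fin 3, IsCompatibleFirst k ((![V, V', 0] : Fin 3 → Op I O) k) := by
    intro k
    fin_cases k
    exacts [hV, hV', IsCompatibleFirst.zero _]
  -- Once `A` or `B` has acted, the other remaining party cannot receive a signal from `C`, so every
  -- bipartite process matrix is compatible with that party first.
  have key : ∀ {J : Fin 2 → Type u} {Q : Fin 2 → Type v} [∀ k, Fintype (J k)]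
      [∀ k, Fintype (Q k)] [∀ k, DecidableEq (J k)] [Unique (Q 1)] {U : Op J Q},
      IsProcess U → IsOGSeparable 2 J Q U := by
    intro J Q _ _ _ _ U hU
    rw [← add_zero U]
    refine isOGSeparable_two ⟨hU, fun M M' h1 h2 => ?_⟩ (IsCompatibleFirst.zero 1)
    have : M = M' := by
      funext k
      fin_cases k
      · exact ((h1 0 rfl).2).symm
      · exact (h2 1 (by simp)).1.unique (h2 1 (by simp)).2
    rw [this]
  have hP := h.1
  rw [e] at hP ⊢
  refine isOGSeparable_sum (n := 1) hP hU fun k M hM => ?_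
  have hp := (hU k).isProcess_conditional hM
  fin_cases k
  · have : Unique (O ((0 : Fin 3).succAbove 1)) := inferInstanceAs (Unique (O 2))
    exact key (J := fun j => I ((0 : Fin 3).succAbove j))
      (Q := fun j => O ((0 : Fin 3).succAbove j)) hp
  · have : Unique (O ((1 : Fin 3).succAbove 1)) := inferInstanceAs (Unique (O 2))
    exact key (J := fun j => I ((1 : Fin 3).succAbove j))
      (Q := fun j => O ((1 : Fin 3).succAbove j)) hp
  · have : (![V, V', 0] : Fin 3 → Op I O) ⟨2, by omega⟩ = 0 := rfl
    rw [this, conditional_zero]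
    exact isOGSeparable_zero 2 _ _

theorem IsAraujoSeparable.isExtensiblyOGSeparable {W : Op I O} (h : IsAraujoSeparable W) :
    IsExtensiblyOGSeparable W := by
  refine ⟨h.isOGSeparable, fun d ρ hρ => ?_⟩
  obtain ⟨V, V', hV, hV', rfl⟩ := isAraujoSeparable_iff.1 h
  refine (isAraujoSeparable_iff.2 ⟨extend V ρ, extend V' ρ, hV.extend hρ.1, hV'.extend hρ.1,
    ?_⟩).isOGSeparable
  ext i j
  simp [extend, add_mul]

end Tripartite

/-! ### Operations that ignore an extra incoming system -/

section Lift

/-- The local operation that acts trivially on an extra incoming system. -/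
def lift {A : Type u} {B : Type v} (X : Type) [DecidableEq X] (M : Matrix (A × B) (A × B) ℂ) :
    Matrix ((A × X) × B) ((A × X) × B) ℂ :=
  Matrix.of fun a b => if a.1.2 = b.1.2 then M (a.1.1, a.2) (b.1.1, b.2) else 0

variable {A : Type u} {B : Type v} {X : Type} [Fintype A] [Fintype B] [Fintype X] [DecidableEq X]

theorem IsCP.lift {M : Matrix (A × B) (A × B) ℂ} (hM : IsCP M) : IsCP (lift X M) := by
  have := posSemidef_blockDiag (fun _ : X => M) (fun _ => hM)
    (fun a : (A × X) × B => (a.1.1, a.2)) (fun a => a.1.2) fun _ => True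
  simpa [IsCP, ProcMat.lift] using this

theorem IsCPTP.lift [DecidableEq A] {M : Matrix (A × B) (A × B) ℂ} (hM : IsCPTP M) :
    IsCPTP (lift X M) := by
  refine ⟨hM.isCP.lift, fun a b => ?_⟩
  by_cases h : a.2 = b.2 <;> simp [ProcMat.lift, h, hM.2, Matrix.one_apply, Prod.ext_iff]

theorem lift_one [DecidableEq A] [DecidableEq B] :
    lift X (1 : Matrix (A × B) (A × B) ℂ) = 1 := by
  ext a b
  simp only [ProcMat.lift, Matrix.of_apply, Matrix.one_apply, Prod.ext_iff]
  split_ifs <;> simp_all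

/-- Acting trivially on the extra systems amounts to tracing them out, which is the sum over `γ`. -/
theorem born_lift {N : ℕ} {I : Fin N → Type u} {O : Fin N → Type v}
    [∀ k, Fintype (I k)] [∀ k, Fintype (O k)] (U : Op (fun k => I k × X) O)
    (M : ∀ k, Matrix (I k × O k) (I k × O k) ℂ) :
    born U (fun k => lift X (M k)) = ∑ i, ∑ j, (∏ k, M k (i k) (j k)) *
      ∑ γ, U (extendEquiv I O (fun _ => X) (γ, j)) (extendEquiv I O (fun _ => X) (γ, i)) := by
  classical
  rw [born_eq_sum]
  simp only [← (extendEquiv I O fun _ => X).sum_comp, Fintype.sum_prod_type]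
  rw [Finset.sum_comm]
  refine Finset.sum_congr rfl fun i _ => ?_
  have e : ∀ γ γ' : Fin N → X, ∀ j, ∏ k, lift X (M k) (extendEquiv I O (fun _ => X) (γ, i) k)
      (extendEquiv I O (fun _ => X) (γ', j) k) =
      if γ = γ' then ∏ k, M k (i k) (j k) else 0 := by
    intro γ γ' j
    simp only [ProcMat.lift, extendEquiv, Equiv.coe_fn_mk, Matrix.of_apply, Prod.mk.eta,
      Finset.prod_ite_zero]
    simp [funext_iff]
  simp_rw [e]
  simp only [ite_mul, zero_mul]
  rw [Finset.sum_congr rfl fun γ _ => Finset.sum_comm]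
  simp only [Finset.sum_ite_eq, Finset.mem_univ, if_true]
  rw [Finset.sum_comm]
  simp [Finset.mul_sum]

end Lift

/-! ### Teleportation of the incoming system of the last party -/

section Teleport

variable {I : Fin 3 → Type u} {O : Fin 3 → Type v}
  [∀ k, Fintype (I k)] [∀ k, Fintype (O k)] [∀ k, DecidableEq (I k)] [Unique (O 2)]
  {n : ℕ} [NeZero n]

/-- Orthogonality of characters; the characters supply the phases of the Bell basis in arbitrary
dimension. -/
theorem sum_addChar_mul_star (a b : Fin n) :
    ∑ ψ : AddChar (Fin n) ℂ, ψ a * star (ψ b) = if a = b then (n : ℂ) else 0 := by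
  have := AddChar.sum_apply_eq_ite (a - b)
  simpa [sub_eq_add_neg, AddChar.map_add_eq_mul, AddChar.map_neg_eq_conj, add_neg_eq_zero]
    using this

theorem addChar_mul_star_self (ψ : AddChar (Fin n) ℂ) (a : Fin n) : ψ a * star (ψ a) = 1 := by
  rw [Complex.star_def, ← AddChar.map_neg_eq_conj, ← AddChar.map_add_eq_mul, add_neg_cancel,
    AddChar.map_zero_eq_one]

/-- The vectors of a Bell measurement on the incoming system of the last party and its extra
incoming system. -/
noncomputable def bellVec {A : Type u} {B : Type v} (e : A ≃ Fin n)
    (ω : AddChar (Fin n) ℂ × Fin n) : (A × Fin n) × B → ℂ :=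
  fun x => if x.1.2 = e x.1.1 + ω.2 then ω.1 (e x.1.1) else 0

/-- The elements of a Bell measurement. -/
noncomputable def bell {A : Type u} {B : Type v} (e : A ≃ Fin n)
    (ω : AddChar (Fin n) ℂ × Fin n) : Matrix ((A × Fin n) × B) ((A × Fin n) × B) ℂ :=
  Matrix.vecMulVec (bellVec e ω) (star (bellVec e ω))

theorem isCP_bell {A : Type u} {B : Type v} [Fintype A] [Fintype B] (e : A ≃ Fin n)
    (ω : AddChar (Fin n) ℂ × Fin n) : IsCP (bell (B := B) e ω) :=
  Matrix.posSemidef_vecMulVec_self_star _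

/-- The Bell vectors have squared norm `n`, hence the factor `n`. Summing over characters forces `a
= b`, and exactly one shift `t` is compatible with given `a` and `x`. -/
theorem sum_bell {A : Type u} {B : Type v} [Fintype A] [DecidableEq A] [DecidableEq B] [Unique B]
    (e : A ≃ Fin n) : ∑ ω, bell (B := B) e ω = (n : ℂ) • 1 := by
  ext ⟨⟨a, x⟩, o⟩ ⟨⟨b, y⟩, o'⟩
  obtain rfl : o = o' := Subsingleton.elim _ _
  simp only [Matrix.sum_apply, bell, Matrix.vecMulVec_apply, bellVec, Pi.star_apply,
    Fintype.sum_prod_type, Matrix.smul_apply, Matrix.one_apply, apply_ite star, star_zero]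
  rw [Finset.sum_comm]
  have h : ∀ t : Fin n, ∑ ψ : AddChar (Fin n) ℂ, (if x = e a + t then ψ (e a) else 0) *
      (if y = e b + t then star (ψ (e b)) else 0) =
      if t = x - e a then (if a = b ∧ x = y then (n : ℂ) else 0) else 0 := by
    intro t
    have := sum_addChar_mul_star (e a) (e b)
    by_cases ht : t = x - e a
    · subst ht
      by_cases hab : a = b
      · subst hab
        by_cases hxy : x = y
        · subst hxy
          simpa using this
        · simp [hxy, Ne.symm hxy]
      · by_cases h2 : y = e b + (x - e a)
        · simp only [add_sub_cancel, if_true, if_pos h2, this, e.injective.eq_iff, hab, false_and,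
            if_false]
        · simp [h2, hab]
    · have : ¬ x = e a + t := fun h => ht (by rw [h]; abel)
      simp [ht, this]
  simp_rw [h]
  by_cases h1 : a = b <;> by_cases h2 : x = y <;> simp [h1, h2]

/-- Basis vectors of the extended systems of the first two parties, where the extra incoming
system of the first party holds the (shifted) state of the last one. -/
def teleportIndex (e : I 2 ≃ Fin n) (t β : Fin n) (i : Sys I O) :
    Sys (fun j : Fin 2 => I ((2 : Fin 3).succAbove j) × Fin n)
      (fun j => O ((2 : Fin 3).succAbove j)) :=
  extendEquiv _ _ (fun _ => Fin n) (![e (i 2).1 + t, β], fun j => i ((2 : Fin 3).succAbove j))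

/-- The operator obtained by correcting the extra incoming system of the first party according to
the outcome of the Bell measurement, and handing it over to the last party. -/
noncomputable def teleport (e : I 2 ≃ Fin n) (ω : AddChar (Fin n) ℂ × Fin n)
    (U : Op (fun j : Fin 2 => I ((2 : Fin 3).succAbove j) × Fin n)
      (fun j => O ((2 : Fin 3).succAbove j))) : Op I O :=
  Matrix.of fun i j => ω.1 (e (i 2).1) * star (ω.1 (e (j 2).1)) *
    ∑ β, U (teleportIndex e ω.2 β i) (teleportIndex e ω.2 β j)

variable (e : I 2 ≃ Fin n) (ω : AddChar (Fin n) ℂ × Fin n)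

theorem teleport_add (U U' : Op (fun j : Fin 2 => I ((2 : Fin 3).succAbove j) × Fin n)
      (fun j => O ((2 : Fin 3).succAbove j))) :
    teleport e ω (U + U') = teleport e ω U + teleport e ω U' := by
  ext i j
  simp [teleport, Finset.sum_add_distrib, mul_add]

theorem teleport_smul (c : ℂ) (U : Op (fun j : Fin 2 => I ((2 : Fin 3).succAbove j) × Fin n)
      (fun j => O ((2 : Fin 3).succAbove j))) :
    teleport e ω (c • U) = c • teleport e ω U := by
  ext i j
  simp only [teleport, Matrix.of_apply, Matrix.smul_apply, smul_eq_mul, ← Finset.mul_sum]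
  ring

theorem teleport_posSemidef {U : Op (fun j : Fin 2 => I ((2 : Fin 3).succAbove j) × Fin n)
      (fun j => O ((2 : Fin 3).succAbove j))} (hU : U.PosSemidef) :
    (teleport e ω U).PosSemidef := by
  have h := (Matrix.posSemidef_vecMulVec_self_star
    (fun i : Sys I O => ω.1 (e (i 2).1))).hadamard
    (Matrix.posSemidef_sum Finset.univ fun β _ => hU.submatrix (teleportIndex (O := O) e ω.2 β))
  have e1 : teleport e ω U = Matrix.hadamard
      (Matrix.vecMulVec (fun i : Sys I O => ω.1 (e (i 2).1)) (star fun i => ω.1 (e (i 2).1)))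
      (∑ β, U.submatrix (teleportIndex e ω.2 β) (teleportIndex e ω.2 β)) := by
    ext i j
    simp [teleport, Matrix.vecMulVec_apply, Matrix.sum_apply]
  rwa [e1]

/-- Against the identity on `C_I` only diagonal entries count: there the correcting phase has
modulus one and the shift merely permutes the basis. The handed-over system is thus traced out, as
if `A` had ignored it. -/
theorem born_teleport (U : Op (fun j : Fin 2 => I ((2 : Fin 3).succAbove j) × Fin n)
      (fun j => O ((2 : Fin 3).succAbove j)))
    {M : ∀ k, Matrix (I k × O k) (I k × O k) ℂ} (hM : IsCPTP (M 2)) :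
    born (teleport e ω U) M =
      born U fun j => lift (Fin n) (M ((2 : Fin 3).succAbove j)) := by
  classical
  rw [born_lift, born_eq_sum]
  have e1 : ∀ f : Sys I O → ℂ, ∑ i, f i =
      ∑ a, ∑ x, f ((2 : Fin 3).insertNth (α := fun l => I l × O l) x a) := by
    intro f
    rw [← (Fin.insertNthEquiv (fun l => I l × O l) 2).sum_comp, Fintype.sum_prod_type_right]
    rfl
  have e2 : ∀ f : (Fin 2 → Fin n) → ℂ, ∑ γ, f γ = ∑ α, ∑ β, f ![α, β] := by
    intro f
    rw [← (finTwoArrowEquiv (Fin n)).symm.sum_comp, Fintype.sum_prod_type]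
    rfl
  simp only [e1, Fin.prod_univ_succAbove _ (2 : Fin 3), Fin.insertNth_apply_same,
    Fin.insertNth_apply_succAbove, teleport, teleportIndex, Matrix.of_apply]
  refine Finset.sum_congr rfl fun a _ => ?_
  rw [Finset.sum_comm]
  refine Finset.sum_congr rfl fun b _ => ?_
  rw [hM.eq_one]
  simp only [Matrix.one_apply, ite_mul, one_mul, zero_mul, Finset.sum_ite_eq, Finset.mem_univ,
    if_true, addChar_mul_star_self]
  rw [← Finset.mul_sum, e2, Fintype.sum_prod_type]
  simp only [Fintype.sum_unique]
  congr 1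
  rw [← (e.trans (Equiv.addRight ω.2)).sum_comp]
  rfl

/-- `C` is always outside the set receiving no signal, so its map is trace preserving and
`born_teleport` transfers every condition to `U`. -/
theorem IsCompatibleFirst.teleport {j : Fin 2}
    {U : Op (fun j : Fin 2 => I ((2 : Fin 3).succAbove j) × Fin n)
      (fun j => O ((2 : Fin 3).succAbove j))} (hU : IsCompatibleFirst j U) :
    IsCompatibleFirst ((2 : Fin 3).succAbove j) (teleport e ω U) := by
  refine ⟨⟨teleport_posSemidef e ω hU.1.1, fun M M' h h' => ?_⟩, fun M M' h h' => ?_⟩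
  · rw [born_teleport e ω U (h 2), born_teleport e ω U (h' 2)]
    exact hU.1.2 _ _ (fun k => (h _).lift) fun k => (h' _).lift
  · have h2 := h' 2 (Fin.ne_succAbove 2 j)
    rw [born_teleport e ω U h2.1, born_teleport e ω U h2.2]
    refine hU.2 _ _ (fun k hk => ?_) fun k hk => ?_
    · obtain rfl : k = j := hk
      exact ⟨(h _ rfl).1.lift, by rw [(h _ rfl).2]⟩
    · have := h' ((2 : Fin 3).succAbove k) fun hc =>
        hk (Fin.succAbove_right_injective (p := 2) hc)
      exact ⟨this.1.lift, this.2.lift⟩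

/-- The sum over all outcomes of the Bell measurement of the corrected operators. -/
noncomputable def teleportSum (V : Op (fun k => I k × Fin n) O) : Op I O :=
  ∑ ω, teleport e ω (conditional 2 (bell e ω) V)

theorem conditional_sum_left {N : ℕ} {I : Fin (N + 1) → Type u} {O : Fin (N + 1) → Type v}
    [∀ k, Fintype (I k)] [∀ k, Fintype (O k)] {ι : Type*} (s : Finset ι) (k : Fin (N + 1))
    (M : ι → Matrix (I k × O k) (I k × O k) ℂ) (W : Op I O) :
    conditional k (∑ a ∈ s, M a) W = ∑ a ∈ s, conditional k (M a) W := by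
  ext a b
  simp_rw [Matrix.sum_apply, conditional, Matrix.of_apply, Matrix.sum_apply, Finset.sum_mul]
  simp_rw [Finset.sum_comm (s := s)]

theorem teleportSum_posSemidef {V : Op (fun k => I k × Fin n) O} (hV : V.PosSemidef) :
    (teleportSum e V).PosSemidef :=
  Matrix.posSemidef_sum _ fun ω _ =>
    teleport_posSemidef e ω (conditional_posSemidef _ (isCP_bell e ω) hV)

/-- Forgetting the Bell outcome is the same as discarding both systems of `C`, by `sum_bell`. -/
theorem born_teleportSum (V : Op (fun k => I k × Fin n) O)
    {M : ∀ k, Matrix (I k × O k) (I k × O k) ℂ} (hM : IsCPTP (M 2)) :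
    born (teleportSum e V) M = n * born V fun k => lift (Fin n) (M k) := by
  classical
  rw [teleportSum, born_sum]
  simp_rw [born_teleport e _ _ hM]
  rw [← born_sum, ← conditional_sum_left, sum_bell, conditional_smul_left, born_smul]
  rw [← born_conditional 2 V, hM.eq_one, lift_one]

theorem IsCompatibleFirst.teleportSum {k : Fin 3} (hk : k ≠ 2)
    {V : Op (fun k => I k × Fin n) O} (hV : IsCompatibleFirst k V) :
    IsCompatibleFirst k (teleportSum e V) := by
  refine ⟨⟨teleportSum_posSemidef e hV.1.1, fun M M' h h' => ?_⟩, fun M M' h h' => ?_⟩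
  · rw [born_teleportSum e V (h 2), born_teleportSum e V (h' 2),
      hV.1.2 _ _ (fun k => (h k).lift) fun k => (h' k).lift]
  · have h2 := h' 2 hk.symm
    rw [born_teleportSum e V h2.1, born_teleportSum e V h2.2]
    rw [hV.2 _ _ (fun k hk => ⟨(h k hk).1.lift, by rw [(h k hk).2]⟩)
      fun k hk => ⟨(h' k hk).1.lift, (h' k hk).2.lift⟩]

theorem teleportSum_add (V V' : Op (fun k => I k × Fin n) O) :
    teleportSum e (V + V') = teleportSum e V + teleportSum e V' := by
  simp [teleportSum, conditional_add, teleport_add, Finset.sum_add_distrib]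

theorem teleportSum_smul (c : ℂ) (V : Op (fun k => I k × Fin n) O) :
    teleportSum e (c • V) = c • teleportSum e V := by
  simp [teleportSum, conditional_smul, conditional_smul_left, teleport_smul, Finset.smul_sum]

/-- The unnormalised maximally entangled state of the extra incoming systems of the first and the
last party, with a fixed state of the second party. -/
def entangledVec (n : ℕ) [NeZero n] : (Fin 3 → Fin n) → ℂ :=
  fun u => if u 0 = u 2 ∧ u 1 = 0 then 1 else 0

/-- The teleportation identity: every single outcome, after correction, reproduces `W` exactly, so
the factor is the number of outcomes. -/
theorem teleportSum_extend (W : Op I O) :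
    teleportSum e (extend W (Matrix.vecMulVec (entangledVec n) (star (entangledVec n)))) =
      (Fintype.card (AddChar (Fin n) ℂ × Fin n) : ℂ) • W := by
  ext i j
  have h : ∀ ω : AddChar (Fin n) ℂ × Fin n, teleport e ω (conditional 2 (bell e ω)
      (extend W (Matrix.vecMulVec (entangledVec n) (star (entangledVec n))))) i j = W i j := by
    classical
    rintro ⟨ψ, t⟩
    let y₀ : Sys I O → (I 2 × Fin n) × O 2 := fun i => (((i 2).1, e (i 2).1 + t), (i 2).2)
    let ins : (I 2 × Fin n) × O 2 → Fin n → Sys I O → Sys (fun k => I k × Fin n) O :=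
      fun y β i => (2 : Fin 3).insertNth (α := fun l => (I l × Fin n) × O l) y
        (teleportIndex e t β i)
    have h1 : ∀ y β i, bellVec e (ψ, t) y * entangledVec n (fun k => (ins y β i k).1.2) =
        if β = 0 ∧ y = y₀ i then ψ (e (i 2).1) else 0 := by
      rintro ⟨⟨c, γ⟩, o⟩ β i
      have e0 : (ins ((c, γ), o) β i 0).1.2 = e (i 2).1 + t := rfl
      have e1 : (ins ((c, γ), o) β i 1).1.2 = β := rfl
      have e2 : (ins ((c, γ), o) β i 2).1.2 = γ := rfl
      have e3 : o = (i 2).2 := Subsingleton.elim _ _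
      simp only [bellVec, entangledVec, e0, e1, e2, y₀, ← e3, Prod.mk.injEq, and_true]
      by_cases hβ : β = 0
      · by_cases hc : c = (i 2).1
        · subst hc
          by_cases hγ : γ = e (i 2).1 + t <;> simp [hβ, hγ, eq_comm]
        · by_cases hγ : γ = e c + t
          · subst hγ
            have : ¬ e (i 2).1 = e c := fun h => hc (e.injective h).symm
            simp [this, hc]
          · simp [hγ, hc]
      · simp [hβ]
    have h2 : ∀ i k, ((ins (y₀ i) 0 i k).1.1, (ins (y₀ i) 0 i k).2) = i k := by
      intro i k
      fin_cases k <;> rfl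
    have h3 : ∀ β x y, bell e (ψ, t) x y *
        extend W (Matrix.vecMulVec (entangledVec n) (star (entangledVec n)))
          (ins y β i) (ins x β j) = if β = 0 then if x = y₀ j then if y = y₀ i then
            star (ψ (e (i 2).1)) * ψ (e (j 2).1) * W i j else 0 else 0 else 0 := by
      intro β x y
      have hv : ∀ u, star (entangledVec n u) = entangledVec n u := by
        intro u
        simp [entangledVec, apply_ite star]
      have h5 : bell e (ψ, t) x y *
          extend W (Matrix.vecMulVec (entangledVec n) (star (entangledVec n)))
            (ins y β i) (ins x β j) =
          star (bellVec e (ψ, t) y * entangledVec n (fun k => (ins y β i k).1.2)) *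
          (bellVec e (ψ, t) x * entangledVec n (fun k => (ins x β j k).1.2)) *
          W (fun k => ((ins y β i k).1.1, (ins y β i k).2))
            (fun k => ((ins x β j k).1.1, (ins x β j k).2)) := by
        simp only [bell, extend, Matrix.vecMulVec_apply, Matrix.of_apply, Pi.star_apply, hv,
          star_mul']
        ring
      rw [h5, h1, h1]
      by_cases hβ : β = 0
      · subst hβ
        by_cases hx : x = y₀ j
        · by_cases hy : y = y₀ i
          · subst hx hy
            simp only [h2, and_self, if_true]
          · simp [hy]
        · simp [hx]
      · simp [hβ]
    have h4 : teleport e (ψ, t) (conditional 2 (bell e (ψ, t))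
        (extend W (Matrix.vecMulVec (entangledVec n) (star (entangledVec n))))) i j =
        ψ (e (i 2).1) * star (ψ (e (j 2).1)) * ∑ β, ∑ x, ∑ y, bell e (ψ, t) x y *
        extend W (Matrix.vecMulVec (entangledVec n) (star (entangledVec n)))
          (ins y β i) (ins x β j) := rfl
    rw [h4]
    simp_rw [h3]
    have h6 : ∀ β : Fin n, (∑ x, ∑ y, if β = 0 then if x = y₀ j then if y = y₀ i then
        star (ψ (e (i 2).1)) * ψ (e (j 2).1) * W i j else 0 else 0 else 0) =
        if β = 0 then star (ψ (e (i 2).1)) * ψ (e (j 2).1) * W i j else 0 := by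
      intro β
      split_ifs <;> simp
    simp_rw [h6, Finset.sum_ite_eq', Finset.mem_univ, if_true]
    linear_combination (ψ (e (j 2).1) * star (ψ (e (j 2).1)) * W i j) *
      addChar_mul_star_self ψ (e (i 2).1) + W i j * addChar_mul_star_self ψ (e (j 2).1)
  simp [teleportSum, Matrix.sum_apply, h]

theorem exists_isState_entangled (n : ℕ) [NeZero n] : ∃ τ : ℝ, 0 < τ ∧
    IsState ((τ⁻¹ : ℂ) • Matrix.vecMulVec (entangledVec n) (star (entangledVec n))) := by
  refine ⟨∑ u, ‖entangledVec n u‖ ^ 2, ?_, ?_, ?_⟩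
  · refine Finset.sum_pos' (fun _ _ => by positivity) ⟨0, Finset.mem_univ _, ?_⟩
    simp [entangledVec]
  · refine (Matrix.posSemidef_vecMulVec_self_star _).smul ?_
    rw [← Complex.ofReal_inv]
    exact Complex.zero_le_real.2 (by positivity)
  · have h : (∑ u, ‖entangledVec n u‖ ^ 2 : ℝ) ≠ 0 := by
      refine (Finset.sum_pos' (fun _ _ => by positivity) ⟨0, Finset.mem_univ _, ?_⟩).ne'
      simp [entangledVec]
    have h' : entangledVec n ⬝ᵥ star (entangledVec n) =
        ((∑ u, ‖entangledVec n u‖ ^ 2 : ℝ) : ℂ) := by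
      simp [dotProduct, Complex.mul_conj']
    rw [Matrix.trace_smul, Matrix.trace_vecMulVec, smul_eq_mul, h', inv_mul_cancel₀]
    exact Complex.ofReal_ne_zero.2 h

theorem IsExtensiblyOGSeparable.isAraujoSeparable_of_nonempty [Nonempty (I 2)] {W : Op I O}
    (h : IsExtensiblyOGSeparable W) : IsAraujoSeparable W := by
  obtain ⟨m, hm⟩ : ∃ m, m = Fintype.card (I 2) := ⟨_, rfl⟩
  have : NeZero m := ⟨by rw [hm]; exact Fintype.card_ne_zero⟩
  have e : I 2 ≃ Fin m := Fintype.equivFinOfCardEq hm.symm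
  obtain ⟨τ, hτ, hρ⟩ := exists_isState_entangled m
  obtain ⟨-, q, V, hq, -, hV, hV'⟩ := (isOGSeparable_succ_succ (n := 1)).1 (h.2 (fun _ => m) _ hρ)
  have hq' : ∀ k, (0 : ℂ) ≤ q k := fun k => Complex.zero_le_real.2 (hq k)
  -- In the term with `C` first, separability of the conditional splits each Bell outcome into an
  -- `A`-first and a `B`-first part; the split may depend on `ω`.
  have hU : ∀ ω, ∃ U U', IsCompatibleFirst 0 U ∧ IsCompatibleFirst 1 U' ∧
      conditional 2 (bell e ω) (V 2) = U + U' := by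
    intro ω
    obtain ⟨-, r, U, hr, -, hU, hU'⟩ := (isOGSeparable_succ_succ (n := 0)).1
      ((hV' 2).2 (bell e ω) (isCP_bell e ω))
    exact ⟨_, _, (hU' 0).1.smul (Complex.zero_le_real.2 (hr 0)),
      (hU' 1).1.smul (Complex.zero_le_real.2 (hr 1)), by rw [hU, Fin.sum_univ_two]⟩
  choose U U' hU0 hU1 hUU using hU
  have key := congrArg (teleportSum e) hV
  have hex : ∀ c : ℂ, ∀ ρ : Matrix (Fin 3 → Fin m) (Fin 3 → Fin m) ℂ,
      extend W (c • ρ) = c • extend W ρ := by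
    intro c ρ
    ext i j
    simp only [extend, Matrix.of_apply, Matrix.smul_apply, smul_eq_mul]
    ring
  have h2 : teleportSum e (V 2) = ∑ ω, teleport e ω (U ω) + ∑ ω, teleport e ω (U' ω) := by
    simp [teleportSum, hUU, teleport_add, Finset.sum_add_distrib]
  rw [hex, teleportSum_smul, teleportSum_extend, Fin.sum_univ_three, teleportSum_add,
    teleportSum_add, teleportSum_smul, teleportSum_smul, teleportSum_smul, h2] at key
  -- `c` undoes the normalisation of the entangled state and the count of Bell outcomes.
  obtain ⟨c, hc, hcW⟩ : ∃ c : ℂ, 0 ≤ c ∧ ∀ Z : Op I O, ((τ⁻¹ : ℂ) •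
      (Fintype.card (AddChar (Fin m) ℂ × Fin m) : ℂ) • W = Z) → W = c • Z := by
    refine ⟨((τ / Fintype.card (AddChar (Fin m) ℂ × Fin m) : ℝ) : ℂ),
      Complex.zero_le_real.2 (by positivity), ?_⟩
    rintro _ rfl
    have h1 : (τ : ℂ) ≠ 0 := Complex.ofReal_ne_zero.2 hτ.ne'
    have h2 : (Fintype.card (AddChar (Fin m) ℂ × Fin m) : ℂ) ≠ 0 :=
      Nat.cast_ne_zero.2 Fintype.card_ne_zero
    rw [smul_smul, smul_smul, mul_assoc, Complex.ofReal_div, Complex.ofReal_natCast]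
    have : (τ : ℂ) / (Fintype.card (AddChar (Fin m) ℂ × Fin m) : ℂ) *
        ((τ : ℂ)⁻¹ * (Fintype.card (AddChar (Fin m) ℂ × Fin m) : ℂ)) = 1 := by
      field_simp
    rw [this, one_smul]
  refine isAraujoSeparable_iff.2 ⟨c • ((q 0 : ℂ) • teleportSum e (V 0) +
    (q 2 : ℂ) • ∑ ω, teleport e ω (U ω)), c • ((q 1 : ℂ) • teleportSum e (V 1) +
    (q 2 : ℂ) • ∑ ω, teleport e ω (U' ω)), ?_, ?_, ?_⟩
  · exact ((((hV' 0).1.teleportSum e (by decide)).smul (hq' 0)).add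
      ((IsCompatibleFirst.sum _ fun ω _ => (hU0 ω).teleport e ω).smul (hq' 2))).smul hc
  · exact ((((hV' 1).1.teleportSum e (by decide)).smul (hq' 1)).add
      ((IsCompatibleFirst.sum _ fun ω _ => (hU1 ω).teleport e ω).smul (hq' 2))).smul hc
  · rw [hcW _ key, ← smul_add]
    congr 1
    rw [smul_add]
    abel

theorem isAraujoSeparable_iff_isExtensiblyOGSeparable {W : Op I O} :
    IsAraujoSeparable W ↔ IsExtensiblyOGSeparable W := by
  refine ⟨IsAraujoSeparable.isExtensiblyOGSeparable, fun h => ?_⟩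
  -- A zero-dimensional `C_I` admits no Bell measurement, but then all operators are zero.
  rcases isEmpty_or_nonempty (I 2) with hI | hI
  · have : IsEmpty (Sys I O) := ⟨fun i => hI.elim (i 2).1⟩
    rw [Subsingleton.elim W 0]
    exact isAraujoSeparable_iff.2 ⟨0, 0, .zero 0, .zero 1, by simp⟩
  · exact h.isAraujoSeparable_of_nonempty

end Teleport

/-! ### Local factorisation of the Pauli operators -/

section Place

theorem place_add_left (c : Matrix (Fin 2) (Fin 2) ℂ)
    (P P' Q : Matrix (Fin 2 × Fin 2) (Fin 2 × Fin 2) ℂ) :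
    place c (P + P') Q = place c P Q + place c P' Q := by
  ext i j
  simp only [place, Matrix.of_apply, Matrix.add_apply]
  ring

theorem place_sub_left (c : Matrix (Fin 2) (Fin 2) ℂ)
    (P P' Q : Matrix (Fin 2 × Fin 2) (Fin 2 × Fin 2) ℂ) :
    place c (P - P') Q = place c P Q - place c P' Q := by
  ext i j
  simp only [place, Matrix.of_apply, Matrix.sub_apply]
  ring

theorem place_add_right (c : Matrix (Fin 2) (Fin 2) ℂ)
    (P Q Q' : Matrix (Fin 2 × Fin 2) (Fin 2 × Fin 2) ℂ) :
    place c P (Q + Q') = place c P Q + place c P Q' := by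
  ext i j
  simp only [place, Matrix.of_apply, Matrix.add_apply]
  ring

theorem place_sub_right (c : Matrix (Fin 2) (Fin 2) ℂ)
    (P Q Q' : Matrix (Fin 2 × Fin 2) (Fin 2 × Fin 2) ℂ) :
    place c P (Q - Q') = place c P Q - place c P Q' := by
  ext i j
  simp only [place, Matrix.of_apply, Matrix.sub_apply]
  ring

theorem place_isHermitian {c : Matrix (Fin 2) (Fin 2) ℂ}
    {P Q : Matrix (Fin 2 × Fin 2) (Fin 2 × Fin 2) ℂ} (hc : c.IsHermitian) (hP : P.IsHermitian)
    (hQ : Q.IsHermitian) : (place c P Q).IsHermitian := by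
  ext i j
  simp only [place, Matrix.conjTranspose_apply, Matrix.of_apply, star_mul', hc.apply, hP.apply,
    hQ.apply]

/-- The basis of the whole system, as pairs of basis vectors of `C_I`, `A_I ⊗ B_I` and
`A_O ⊗ B_O`. -/
def placeEquiv : Sys QI QO ≃ Fin 2 × ((Fin 2 × Fin 2) × (Fin 2 × Fin 2)) where
  toFun i := ((i 2).1, ((i 0).1, (i 1).1), (outA (i 0).2, outB (i 1).2))
  invFun p := fun k => match k with
    | 0 => (p.2.1.1, outA.symm p.2.2.1)
    | 1 => (p.2.1.2, outB.symm p.2.2.2)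
    | 2 => (p.1, default)
  left_inv i := by
    funext k
    fin_cases k
    · rfl
    · rfl
    · exact Prod.ext rfl (Subsingleton.elim (α := QO 2) _ _)
  right_inv _ := rfl

theorem place_eq_submatrix (c : Matrix (Fin 2) (Fin 2) ℂ)
    (P Q : Matrix (Fin 2 × Fin 2) (Fin 2 × Fin 2) ℂ) :
    place c P Q = (c ⊗ₖ (P ⊗ₖ Q)).submatrix placeEquiv placeEquiv := by
  ext i j
  exact mul_assoc _ _ _

theorem trace_place_mul_place (c c' : Matrix (Fin 2) (Fin 2) ℂ)
    (P P' Q Q' : Matrix (Fin 2 × Fin 2) (Fin 2 × Fin 2) ℂ) :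
    (place c P Q * place c' P' Q').trace =
      (c * c').trace * ((P * P').trace * (Q * Q').trace) := by
  rw [place_eq_submatrix, place_eq_submatrix, Matrix.submatrix_mul_equiv,
    ← Matrix.mul_kronecker_mul, ← Matrix.mul_kronecker_mul, ← Matrix.trace_kronecker,
    ← Matrix.trace_kronecker]
  exact placeEquiv.sum_comp fun p =>
    ((c * c') ⊗ₖ ((P * P') ⊗ₖ (Q * Q'))) p p

/-- Three local operators. -/
def locals (A B : Matrix (Fin 2 × Fin 2) (Fin 2 × Fin 2) ℂ)
    (C : Matrix (Fin 2 × Fin 1) (Fin 2 × Fin 1) ℂ) :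
    ∀ k : Fin 3, Matrix (QI k × QO k) (QI k × QO k) ℂ := fun k => match k with
  | 0 => A
  | 1 => B
  | 2 => C

/-- Regrouping a Pauli string by parties makes its Born value a product of local traces. -/
theorem place_kronecker (c A B C D : Matrix (Fin 2) (Fin 2) ℂ) :
    place c (A ⊗ₖ B) (C ⊗ₖ D) = tensor (locals (A ⊗ₖ C) (B ⊗ₖ D) (c ⊗ₖ 1)) := by
  ext i j
  have h : (i 2).2 = (j 2).2 := Subsingleton.elim (α := QO 2) _ _
  have h2 : (1 : Matrix (Fin 1) (Fin 1) ℂ) (i 2).2 (j 2).2 = 1 := by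
    rw [h]
    exact Matrix.one_apply_eq _
  have h3 : tensor (locals (A ⊗ₖ C) (B ⊗ₖ D) (c ⊗ₖ 1)) i j =
      ((A (i 0).1 (j 0).1 * C (i 0).2 (j 0).2) * (B (i 1).1 (j 1).1 * D (i 1).2 (j 1).2)) *
      (c (i 2).1 (j 2).1 * (1 : Matrix (Fin 1) (Fin 1) ℂ) (i 2).2 (j 2).2) := by
    simp only [tensor, Matrix.of_apply, Fin.prod_univ_three]
    rfl
  rw [h3, h2]
  simp only [place, Matrix.of_apply, Matrix.kroneckerMap_apply]
  change c _ _ * (A _ _ * B _ _) * (C (i 0).2 (j 0).2 * D (i 1).2 (j 1).2) = _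
  ring

theorem exists_eq_locals (M : ∀ k, Matrix (QI k × QO k) (QI k × QO k) ℂ) :
    ∃ A B C, M = locals A B C :=
  ⟨M 0, M 1, M 2, by funext k; fin_cases k <;> rfl⟩

theorem born_place_kronecker (c P P' Q Q' : Matrix (Fin 2) (Fin 2) ℂ)
    (A B : Matrix (Fin 2 × Fin 2) (Fin 2 × Fin 2) ℂ)
    (C : Matrix (Fin 2 × Fin 1) (Fin 2 × Fin 1) ℂ) :
    born (place c (P ⊗ₖ P') (Q ⊗ₖ Q')) (locals A B C) =
      (A * (P ⊗ₖ Q)).trace * (B * (P' ⊗ₖ Q')).trace * (C * (c ⊗ₖ 1)).trace := by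
  rw [born, place_kronecker, trace_tensor_mul_tensor, Fin.prod_univ_three]
  rfl

/-- An identity on the outgoing system makes the local trace blind to the choice of CPTP map, and
zero for a traceless Pauli. The no-signalling checks for `Wact` and its halves rest on this. -/
theorem IsCPTP.trace_mul_kronecker_one {A B : Type} [Fintype A] [Fintype B] [DecidableEq A]
    [DecidableEq B] {M : Matrix (A × B) (A × B) ℂ} (hM : IsCPTP M) (P : Matrix A A ℂ) :
    (M * (P ⊗ₖ (1 : Matrix B B ℂ))).trace = P.trace := by
  have h : (M * (P ⊗ₖ (1 : Matrix B B ℂ))).trace =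
      ∑ a, ∑ a', (∑ b, M (a, b) (a', b)) * P a' a := by
    simp only [Matrix.trace, Matrix.diag, Matrix.mul_apply, Matrix.kroneckerMap_apply,
      Fintype.sum_prod_type, Matrix.one_apply, mul_ite, mul_one, mul_zero, Finset.sum_ite_eq',
      Finset.mem_univ, if_true, Finset.sum_mul]
    exact Finset.sum_congr rfl fun a _ => Finset.sum_comm
  rw [h]
  simp only [hM.2, Matrix.one_apply, ite_mul, one_mul, zero_mul, Finset.sum_ite_eq,
    Finset.mem_univ, if_true]
  rfl

theorem IsCPTP.trace_mul_kronecker_id2 {A : Type} [Fintype A] [DecidableEq A]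
    {M : Matrix (A × Fin 2) (A × Fin 2) ℂ} (hM : IsCPTP M) (P : Matrix A A ℂ) :
    (M * (P ⊗ₖ id2)).trace = P.trace :=
  hM.trace_mul_kronecker_one P

theorem trace_σX : σX.trace = 0 := by simp [σX, Matrix.trace, Fin.sum_univ_two]
theorem trace_σY : σY.trace = 0 := by simp [σY, Matrix.trace, Fin.sum_univ_two]
theorem trace_σZ : σZ.trace = 0 := by simp [σZ, Matrix.trace, Fin.sum_univ_two]

theorem isHermitian_σX : σX.IsHermitian := by
  ext i j; fin_cases i <;> fin_cases j <;> simp [σX]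
theorem isHermitian_σY : σY.IsHermitian := by
  ext i j; fin_cases i <;> fin_cases j <;> simp [σY]
theorem isHermitian_σZ : σZ.IsHermitian := by
  ext i j; fin_cases i <;> fin_cases j <;> simp [σZ]
theorem isHermitian_id2 : id2.IsHermitian := Matrix.isHermitian_one

theorem IsHermitian.kronecker {A B : Type} {P : Matrix A A ℂ} {Q : Matrix B B ℂ}
    (hP : P.IsHermitian) (hQ : Q.IsHermitian) : (P ⊗ₖ Q).IsHermitian := by
  rw [Matrix.IsHermitian, Matrix.conjTranspose_kronecker, hP, hQ]

theorem trace_Sact_mul_Wact : (Sact * Wact).trace = ((2 - 4 / √3 : ℝ) : ℂ) := by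
  have h3 : (√3 : ℂ) * √3 = 3 := by
    rw [← Complex.ofReal_mul, Real.mul_self_sqrt (by norm_num)]; norm_num
  have h0 : (√3 : ℂ) ≠ 0 := fun h => by simp [h] at h3
  have c1 : (id2 * id2).trace = 2 := by simp [id2]
  have c2 : (id2 * σZ).trace = 0 := by simp [id2, trace_σZ]
  have c3 : (id2 * σX).trace = 0 := by simp [id2, trace_σX]
  have c4 : (σZ * id2).trace = 0 := by simp [id2, trace_σZ]
  have c5 : (σX * id2).trace = 0 := by simp [id2, trace_σX]
  have c6 : (σY * id2).trace = 0 := by simp [id2, trace_σY]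
  have c7 : (σZ * σZ).trace = 2 := by norm_num [σZ, Matrix.trace, Fin.sum_univ_two]
  have c8 : (σX * σX).trace = 2 := by norm_num [σX, Matrix.trace, Fin.sum_univ_two]
  have c9 : (σY * σY).trace = 2 := by norm_num [σY, Matrix.trace, Fin.sum_univ_two]
  have c10 : (σZ * σX).trace = 0 := by simp [σZ, σX, Matrix.trace, Fin.sum_univ_two]
  have c11 : (σX * σZ).trace = 0 := by simp [σZ, σX, Matrix.trace, Fin.sum_univ_two]
  have c12 : (σY * σX).trace = 0 := by simp [σY, σX, Matrix.trace, Fin.sum_univ_two]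
  have c13 : (σY * σZ).trace = 0 := by simp [σY, σZ, Matrix.trace, Fin.sum_univ_two]
  have c14 : (σX * σY).trace = 0 := by simp [σY, σX, Matrix.trace, Fin.sum_univ_two]
  have c15 : (σZ * σY).trace = 0 := by simp [σY, σZ, Matrix.trace, Fin.sum_univ_two]
  have c16 : (id2 * σY).trace = 0 := by simp [id2, trace_σY]
  simp only [Sact, Wact, Matrix.smul_mul, Matrix.mul_smul, add_mul, mul_add, sub_mul, mul_sub,
    Matrix.trace_add, Matrix.trace_sub, Matrix.trace_smul, trace_place_mul_place,
    ← Matrix.mul_kronecker_mul, Matrix.trace_kronecker, c1, c2, c3, c4, c5, c6, c7, c8, c9, c10,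
    c11, c12, c13, c14, c15, c16, smul_eq_mul]
  push_cast
  field_simp
  ring_nf
  linear_combination (-256 : ℂ) * h3

theorem two_sub_four_div_sqrt_three_neg : (2 - 4 / √3 : ℝ) < 0 := by
  have h : √3 < 2 := by
    rw [Real.sqrt_lt' (by norm_num)]; norm_num
  have h0 : (0 : ℝ) < √3 := Real.sqrt_pos.2 (by norm_num)
  rw [sub_neg, lt_div_iff₀ h0]
  linarith

end Place

/-! ### Block structure in the bases of the outgoing systems -/

section Blocks

/-- The eigenvalues of `σZ`. -/
def sgn (a : Fin 2) : ℂ := if a = 0 then 1 else -1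

theorem sgn_mul_self (a : Fin 2) : sgn a * sgn a = 1 := by
  fin_cases a <;> simp [sgn]

theorem star_sgn (a : Fin 2) : star (sgn a) = sgn a := by
  fin_cases a <;> simp [sgn]

/-- The operator on two qubits that is `τ` on the span of `|01⟩`, `|10⟩`. -/
def antiparallel (τ : Matrix (Fin 2) (Fin 2) ℂ) : Matrix (Fin 2 × Fin 2) (Fin 2 × Fin 2) ℂ :=
  Matrix.of fun a b => if a.1 ≠ a.2 ∧ b.1 ≠ b.2 then τ a.1 b.1 else 0

theorem id_sub_ZZ_eq : id2 ⊗ₖ id2 - σZ ⊗ₖ σZ = antiparallel ((2 : ℂ) • id2) := by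
  ext ⟨a, a'⟩ ⟨b, b'⟩
  fin_cases a <;> fin_cases a' <;> fin_cases b <;> fin_cases b' <;>
    norm_num [id2, σZ, antiparallel]

theorem XX_add_YY_eq : σX ⊗ₖ σX + σY ⊗ₖ σY = antiparallel ((2 : ℂ) • σX) := by
  ext ⟨a, a'⟩ ⟨b, b'⟩
  fin_cases a <;> fin_cases a' <;> fin_cases b <;> fin_cases b' <;>
    norm_num [σX, σY, antiparallel]

theorem Z_sub_Z_eq : σZ ⊗ₖ id2 - id2 ⊗ₖ σZ = antiparallel ((2 : ℂ) • σZ) := by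
  ext ⟨a, a'⟩ ⟨b, b'⟩
  fin_cases a <;> fin_cases a' <;> fin_cases b <;> fin_cases b' <;>
    norm_num [id2, σZ, antiparallel]

theorem XY_sub_YX_eq : σX ⊗ₖ σY - σY ⊗ₖ σX = antiparallel ((-2 : ℂ) • σY) := by
  ext ⟨a, a'⟩ ⟨b, b'⟩
  fin_cases a <;> fin_cases a' <;> fin_cases b <;> fin_cases b' <;>
    norm_num [σX, σY, antiparallel] <;> ring

theorem id_kronecker_id_eq : id2 ⊗ₖ id2 = Matrix.diagonal fun _ => 1 := by
  ext ⟨a, a'⟩ ⟨b, b'⟩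
  fin_cases a <;> fin_cases a' <;> fin_cases b <;> fin_cases b' <;>
    simp [id2]

theorem Z_kronecker_id_eq : σZ ⊗ₖ id2 = Matrix.diagonal fun g => sgn g.1 := by
  ext ⟨a, a'⟩ ⟨b, b'⟩
  fin_cases a <;> fin_cases a' <;> fin_cases b <;> fin_cases b' <;>
    simp [id2, σZ, sgn]

theorem id_kronecker_Z_eq : id2 ⊗ₖ σZ = Matrix.diagonal fun g => sgn g.2 := by
  ext ⟨a, a'⟩ ⟨b, b'⟩
  fin_cases a <;> fin_cases a' <;> fin_cases b <;> fin_cases b' <;>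
    simp [id2, σZ, sgn]

theorem Z_kronecker_Z_eq : σZ ⊗ₖ σZ = Matrix.diagonal fun g => sgn g.1 * sgn g.2 := by
  ext ⟨a, a'⟩ ⟨b, b'⟩
  fin_cases a <;> fin_cases a' <;> fin_cases b <;> fin_cases b' <;>
    simp [σZ, sgn]

/-- `1 + G` is twice a projection: `(1 + G)ᴴ (1 + G) = 2 (1 + G)`. -/
theorem posSemidef_one_add {X : Type*} [Fintype X] [DecidableEq X] {G : Matrix X X ℂ}
    (hG : G.IsHermitian) (hG2 : G * G = 1) : (1 + G).PosSemidef := by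
  have h := (Matrix.posSemidef_conjTranspose_mul_self (1 + G)).smul
    (Complex.zero_le_real.2 (by norm_num : (0 : ℝ) ≤ 1 / 2))
  convert h using 1
  rw [Matrix.conjTranspose_add, hG, Matrix.conjTranspose_one, add_mul, mul_add, mul_add, hG2]
  ext i j
  simp
  ring

/-- The operator on `C_I` and the span of `|01⟩`, `|10⟩` in `A_I ⊗ B_I` that `Wact` is for each
basis vector of `A_O ⊗ B_O`. -/
noncomputable def blockW (g : Fin 2 × Fin 2) : Matrix (Fin 2 × Fin 2) (Fin 2 × Fin 2) ℂ :=
  (1 / 4 : ℂ) • (1 + ((√3 / 4 : ℝ) : ℂ) • (sgn g.1 + sgn g.2) • (id2 ⊗ₖ σX)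
    + (1 / 2 : ℂ) • (σZ ⊗ₖ σZ) - (1 / 4 : ℂ) • (sgn g.1 - sgn g.2) • (σX ⊗ₖ σY))

theorem σX_mul_self : σX * σX = 1 := by
  ext i j; fin_cases i <;> fin_cases j <;> simp [σX]
theorem σY_mul_self : σY * σY = 1 := by
  ext i j; fin_cases i <;> fin_cases j <;> simp [σY]
theorem σZ_mul_self : σZ * σZ = 1 := by
  ext i j; fin_cases i <;> fin_cases j <;> simp [σZ]
theorem σX_mul_σZ : σX * σZ = -(σZ * σX) := by
  ext i j; fin_cases i <;> fin_cases j <;> simp [σX, σZ]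

theorem _root_.Matrix.IsHermitian.ofReal_smul {X : Type*} {P : Matrix X X ℂ}
    (hP : P.IsHermitian) (r : ℝ) : ((r : ℂ) • P).IsHermitian := by
  rw [Matrix.IsHermitian, Matrix.conjTranspose_smul, hP]
  simp

theorem blockW_posSemidef (g : Fin 2 × Fin 2) : (blockW g).PosSemidef := by
  have hZZ : (σZ ⊗ₖ σZ).IsHermitian := IsHermitian.kronecker isHermitian_σZ isHermitian_σZ
  have hX : (id2 ⊗ₖ σX).IsHermitian := IsHermitian.kronecker isHermitian_id2 isHermitian_σX
  have hXY : (σX ⊗ₖ σY).IsHermitian := IsHermitian.kronecker isHermitian_σX isHermitian_σY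
  -- For equal outgoing values, the two Pauli terms anticommute and their squared coefficients `3/4`
  -- and `1/4` add up to one.
  have same : ∀ r : ℝ, r * r = 3 / 4 →
      (1 + ((r : ℂ) • (id2 ⊗ₖ σX) + ((1 / 2 : ℝ) : ℂ) • (σZ ⊗ₖ σZ))).PosSemidef := by
    intro r hr
    have hr' : (r : ℂ) * r = 3 / 4 := by rw [← Complex.ofReal_mul, hr]; norm_num
    refine posSemidef_one_add ((hX.ofReal_smul r).add (hZZ.ofReal_smul _)) ?_
    simp only [add_mul, mul_add, Matrix.smul_mul, Matrix.mul_smul, ← Matrix.mul_kronecker_mul,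
      σX_mul_self, σZ_mul_self, σX_mul_σZ, id2, one_mul, mul_one, Matrix.one_kronecker_one]
    ext i j
    simp only [Matrix.add_apply, Matrix.smul_apply, Matrix.kroneckerMap_apply, Matrix.neg_apply,
      smul_eq_mul]
    push_cast
    linear_combination (1 : Matrix (Fin 2 × Fin 2) (Fin 2 × Fin 2) ℂ) i j * hr'
  -- For opposite outgoing values, the block is an average of two operators of the form `1 + G`.
  have opp : ∀ r : ℝ, r * r = 1 →
      ((1 + σZ ⊗ₖ σZ) + (1 + (r : ℂ) • (σX ⊗ₖ σY))).PosSemidef := by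
    intro r hr
    have hr' : (r : ℂ) * r = 1 := by rw [← Complex.ofReal_mul, hr, Complex.ofReal_one]
    refine (posSemidef_one_add hZZ ?_).add (posSemidef_one_add (hXY.ofReal_smul r) ?_)
    · simp [← Matrix.mul_kronecker_mul, σZ_mul_self]
    · rw [Matrix.smul_mul, Matrix.mul_smul, smul_smul, hr', one_smul, ← Matrix.mul_kronecker_mul,
        σX_mul_self, σY_mul_self, Matrix.one_kronecker_one]
  have hs : ∀ r : ℝ, r * r = 3 / 4 → ∀ g, sgn g.1 = sgn g.2 → (r : ℂ) = √3 / 2 * sgn g.1 →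
      (blockW g).PosSemidef := by
    intro r hr g hg h
    convert (same r hr).smul (Complex.zero_le_real.2 (by norm_num : (0 : ℝ) ≤ 1 / 4)) using 1
    rw [blockW, ← hg, h]
    ext i j
    simp
    ring
  have ho : ∀ r : ℝ, r * r = 1 → ∀ g, sgn g.2 = -sgn g.1 → (r : ℂ) = -sgn g.1 →
      (blockW g).PosSemidef := by
    intro r hr g hg h
    convert (opp r hr).smul (Complex.zero_le_real.2 (by norm_num : (0 : ℝ) ≤ 1 / 8)) using 1
    rw [blockW, hg, h]
    ext i j
    simp
    ring
  have h34 : √3 * √3 = 3 := Real.mul_self_sqrt (by norm_num)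
  obtain ⟨a, b⟩ := g
  fin_cases a <;> fin_cases b
  · exact hs (√3 / 2) (by linarith) _ rfl (by simp [sgn])
  · exact ho (-1) (by norm_num) _ (by simp [sgn]) (by simp [sgn])
  · exact ho 1 (by norm_num) _ (by simp [sgn]) (by simp [sgn])
  · exact hs (-(√3 / 2)) (by linarith) _ rfl (by simp [sgn])

/-- The operator that is `N g` on `C_I` and the span of `|01⟩`, `|10⟩` in `A_I ⊗ B_I`, for each
basis vector `g` of `A_O ⊗ B_O`. -/
def blockOp (N : Fin 2 × Fin 2 → Matrix (Fin 2 × Fin 2) (Fin 2 × Fin 2) ℂ) : Op QI QO :=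
  Matrix.of fun i j =>
    if (outA (i 0).2, outB (i 1).2) = (outA (j 0).2, outB (j 1).2) ∧
        (i 0).1 ≠ (i 1).1 ∧ (j 0).1 ≠ (j 1).1 then
      N (outA (i 0).2, outB (i 1).2) ((i 2).1, (i 0).1) ((j 2).1, (j 0).1) else 0

theorem blockOp_posSemidef {N : Fin 2 × Fin 2 → Matrix (Fin 2 × Fin 2) (Fin 2 × Fin 2) ℂ}
    (hN : ∀ g, (N g).PosSemidef) : (blockOp N).PosSemidef :=
  posSemidef_blockDiag N hN (fun i : Sys QI QO => ((i 2).1, (i 0).1))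
    (fun i => (outA (i 0).2, outB (i 1).2)) fun i => (i 0).1 ≠ (i 1).1

theorem place_antiparallel_diagonal (c τ : Matrix (Fin 2) (Fin 2) ℂ) (q : Fin 2 × Fin 2 → ℂ) :
    place c (antiparallel τ) (Matrix.diagonal q) = blockOp fun g => q g • (c ⊗ₖ τ) := by
  ext i j
  simp only [place, blockOp, antiparallel, Matrix.of_apply, Matrix.diagonal_apply,
    Matrix.smul_apply, Matrix.kroneckerMap_apply, smul_eq_mul, ite_and]
  split_ifs <;> ring

theorem blockOp_add (N N' : Fin 2 × Fin 2 → Matrix (Fin 2 × Fin 2) (Fin 2 × Fin 2) ℂ) :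
    blockOp N + blockOp N' = blockOp (N + N') := by
  ext i j
  simp only [blockOp, Matrix.of_apply, Matrix.add_apply, Pi.add_apply]
  split_ifs <;> simp

theorem blockOp_sub (N N' : Fin 2 × Fin 2 → Matrix (Fin 2 × Fin 2) (Fin 2 × Fin 2) ℂ) :
    blockOp N - blockOp N' = blockOp (N - N') := by
  ext i j
  simp only [blockOp, Matrix.of_apply, Matrix.sub_apply, Pi.sub_apply]
  split_ifs <;> simp

theorem smul_blockOp (c : ℂ) (N : Fin 2 × Fin 2 → Matrix (Fin 2 × Fin 2) (Fin 2 × Fin 2) ℂ) :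
    c • blockOp N = blockOp (c • N) := by
  ext i j
  simp only [blockOp, Matrix.of_apply, Matrix.smul_apply, Pi.smul_apply]
  split_ifs <;> simp

theorem Wact_eq_blockOp : Wact = blockOp blockW := by
  rw [Wact, XX_add_YY_eq, id_sub_ZZ_eq, XY_sub_YX_eq]
  -- Only the first occurrence acts on `A_I ⊗ B_I`; the later one acts on the outgoing systems and
  -- must stay diagonal.
  nth_rw 1 [Z_sub_Z_eq]
  rw [Z_kronecker_id_eq, id_kronecker_Z_eq, id_kronecker_id_eq, Matrix.diagonal_add,
    Matrix.diagonal_sub]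
  simp only [place_antiparallel_diagonal, blockOp_add, smul_blockOp]
  congr 1
  funext g
  have h1 : (1 : Matrix (Fin 2 × Fin 2) (Fin 2 × Fin 2) ℂ) = id2 ⊗ₖ id2 := by simp [id2]
  simp only [blockW, Pi.add_apply, Pi.smul_apply, Matrix.kronecker_smul, h1]
  module

theorem Wact_posSemidef : Wact.PosSemidef :=
  Wact_eq_blockOp ▸ blockOp_posSemidef blockW_posSemidef

end Blocks

/-! ### Causal separability of `Wact` in the sense of Oreshkov and Giarmatzi -/

section OG

/-- Operators of the parties `A` and `B`. -/
abbrev OpAB : Type :=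
  Op (fun j : Fin 2 => QI ((2 : Fin 3).succAbove j)) (fun j => QO ((2 : Fin 3).succAbove j))

/-- The operator acting as `P` on `A_I ⊗ B_I` and as `Q` on `A_O ⊗ B_O`. -/
def placeAB (P Q : Matrix (Fin 2 × Fin 2) (Fin 2 × Fin 2) ℂ) : OpAB :=
  Matrix.of fun i j =>
    P ((i 0).1, (i 1).1) ((j 0).1, (j 1).1) *
      Q (outA (i 0).2, outB (i 1).2) (outA (j 0).2, outB (j 1).2)

/-- Two local operators. -/
def localsAB (A B : Matrix (Fin 2 × Fin 2) (Fin 2 × Fin 2) ℂ) :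
    ∀ j : Fin 2, Matrix (QI ((2 : Fin 3).succAbove j) × QO ((2 : Fin 3).succAbove j))
      (QI ((2 : Fin 3).succAbove j) × QO ((2 : Fin 3).succAbove j)) ℂ := fun j => match j with
  | 0 => A
  | 1 => B

theorem exists_eq_localsAB (M : ∀ j : Fin 2,
    Matrix (QI ((2 : Fin 3).succAbove j) × QO ((2 : Fin 3).succAbove j))
      (QI ((2 : Fin 3).succAbove j) × QO ((2 : Fin 3).succAbove j)) ℂ) :
    ∃ A B, M = localsAB A B :=
  ⟨M 0, M 1, by funext k; fin_cases k <;> rfl⟩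

theorem placeAB_kronecker (P P' Q Q' : Matrix (Fin 2) (Fin 2) ℂ) :
    placeAB (P ⊗ₖ P') (Q ⊗ₖ Q') = tensor (localsAB (P ⊗ₖ Q) (P' ⊗ₖ Q')) := by
  ext i j
  have h : tensor (localsAB (P ⊗ₖ Q) (P' ⊗ₖ Q')) i j =
      (P (i 0).1 (j 0).1 * Q (i 0).2 (j 0).2) * (P' (i 1).1 (j 1).1 * Q' (i 1).2 (j 1).2) := by
    simp only [tensor, Matrix.of_apply, Fin.prod_univ_two]
    rfl
  rw [h]
  exact mul_mul_mul_comm _ _ _ _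

theorem born_placeAB_kronecker (P P' Q Q' : Matrix (Fin 2) (Fin 2) ℂ)
    (A B : Matrix (Fin 2 × Fin 2) (Fin 2 × Fin 2) ℂ) :
    born (placeAB (P ⊗ₖ P') (Q ⊗ₖ Q')) (localsAB A B) =
      (A * (P ⊗ₖ Q)).trace * (B * (P' ⊗ₖ Q')).trace := by
  rw [born, placeAB_kronecker, trace_tensor_mul_tensor, Fin.prod_univ_two]
  rfl

theorem placeAB_add_left (P P' Q : Matrix (Fin 2 × Fin 2) (Fin 2 × Fin 2) ℂ) :
    placeAB (P + P') Q = placeAB P Q + placeAB P' Q := by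
  ext i j
  simp only [placeAB, Matrix.of_apply, Matrix.add_apply]
  ring

theorem placeAB_sub_left (P P' Q : Matrix (Fin 2 × Fin 2) (Fin 2 × Fin 2) ℂ) :
    placeAB (P - P') Q = placeAB P Q - placeAB P' Q := by
  ext i j
  simp only [placeAB, Matrix.of_apply, Matrix.sub_apply]
  ring

theorem placeAB_add_right (P Q Q' : Matrix (Fin 2 × Fin 2) (Fin 2 × Fin 2) ℂ) :
    placeAB P (Q + Q') = placeAB P Q + placeAB P Q' := by
  ext i j
  simp only [placeAB, Matrix.of_apply, Matrix.add_apply]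
  ring

theorem placeAB_sub_right (P Q Q' : Matrix (Fin 2 × Fin 2) (Fin 2 × Fin 2) ℂ) :
    placeAB P (Q - Q') = placeAB P Q - placeAB P Q' := by
  ext i j
  simp only [placeAB, Matrix.of_apply, Matrix.sub_apply]
  ring

/-- The coefficient of the operator `c` on `C_I` in the operation `M` of `C`. -/
def coeffC (M : Matrix (QI 2 × QO 2) (QI 2 × QO 2) ℂ) (c : Matrix (Fin 2) (Fin 2) ℂ) : ℂ :=
  ∑ x, ∑ y, M x y * c y.1 x.1

theorem conditional_place (M : Matrix (QI 2 × QO 2) (QI 2 × QO 2) ℂ)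
    (c : Matrix (Fin 2) (Fin 2) ℂ) (P Q : Matrix (Fin 2 × Fin 2) (Fin 2 × Fin 2) ℂ) :
    conditional 2 M (place c P Q) = coeffC M c • placeAB P Q := by
  ext a b
  rw [coeffC, Matrix.smul_apply, smul_eq_mul, Finset.sum_mul, conditional, Matrix.of_apply]
  refine Finset.sum_congr rfl fun x _ => ?_
  rw [Finset.sum_mul]
  refine Finset.sum_congr rfl fun y _ => ?_
  change M x y * (c y.1 x.1 * P ((a 0).1, (a 1).1) ((b 0).1, (b 1).1) *
      Q (outA (a 0).2, outB (a 1).2) (outA (b 0).2, outB (b 1).2)) =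
    M x y * c y.1 x.1 * (P ((a 0).1, (a 1).1) ((b 0).1, (b 1).1) *
      Q (outA (a 0).2, outB (a 1).2) (outA (b 0).2, outB (b 1).2))
  ring

/-- The operator that is `N g` on the span of `|01⟩`, `|10⟩` in `A_I ⊗ B_I`, for each
basis vector `g` of `A_O ⊗ B_O`. -/
def blockOpAB (N : Fin 2 × Fin 2 → Matrix (Fin 2) (Fin 2) ℂ) : OpAB :=
  Matrix.of fun i j =>
    if (outA (i 0).2, outB (i 1).2) = (outA (j 0).2, outB (j 1).2) ∧
        (i 0).1 ≠ (i 1).1 ∧ (j 0).1 ≠ (j 1).1 then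
      N (outA (i 0).2, outB (i 1).2) (i 0).1 (j 0).1 else 0

theorem blockOpAB_posSemidef {N : Fin 2 × Fin 2 → Matrix (Fin 2) (Fin 2) ℂ}
    (hN : ∀ g, (N g).PosSemidef) : (blockOpAB N).PosSemidef :=
  posSemidef_blockDiag N hN (fun i : Sys (fun j : Fin 2 => QI ((2 : Fin 3).succAbove j))
    (fun j => QO ((2 : Fin 3).succAbove j)) => (i 0).1)
    (fun i => (outA (i 0).2, outB (i 1).2)) fun i => (i 0).1 ≠ (i 1).1

theorem placeAB_antiparallel_diagonal (τ : Matrix (Fin 2) (Fin 2) ℂ) (q : Fin 2 × Fin 2 → ℂ) :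
    placeAB (antiparallel τ) (Matrix.diagonal q) = blockOpAB fun g => q g • τ := by
  ext i j
  simp only [placeAB, blockOpAB, antiparallel, Matrix.of_apply, Matrix.diagonal_apply,
    Matrix.smul_apply, smul_eq_mul, ite_and]
  split_ifs <;> ring

theorem blockOpAB_add (N N' : Fin 2 × Fin 2 → Matrix (Fin 2) (Fin 2) ℂ) :
    blockOpAB N + blockOpAB N' = blockOpAB (N + N') := by
  ext i j
  simp only [blockOpAB, Matrix.of_apply, Matrix.add_apply, Pi.add_apply]
  split_ifs <;> simp

theorem smul_blockOpAB (c : ℂ) (N : Fin 2 × Fin 2 → Matrix (Fin 2) (Fin 2) ℂ) :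
    c • blockOpAB N = blockOpAB (c • N) := by
  ext i j
  simp only [blockOpAB, Matrix.of_apply, Matrix.smul_apply, Pi.smul_apply]
  split_ifs <;> simp

/-- One half of the conditional operator of `Wact`, with `Z` acting on one of the outgoing
systems (as specified by `Q`), and with sign `κ` in the last term. -/
noncomputable def halfAct (M : Matrix (QI 2 × QO 2) (QI 2 × QO 2) ℂ) (κ : ℝ)
    (Q : Matrix (Fin 2 × Fin 2) (Fin 2 × Fin 2) ℂ) : OpAB :=
  (1 / 16 : ℂ) • (coeffC M id2 • placeAB (id2 ⊗ₖ id2 - σZ ⊗ₖ σZ) (id2 ⊗ₖ id2)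
    + (((√3 / 2 : ℝ) : ℂ) * coeffC M id2) • placeAB (σX ⊗ₖ σX + σY ⊗ₖ σY) Q
    + (1 / 2 * coeffC M σZ) • placeAB (σZ ⊗ₖ id2 - id2 ⊗ₖ σZ) (id2 ⊗ₖ id2)
    + (1 / 2 * κ * coeffC M σX) • placeAB (σX ⊗ₖ σY - σY ⊗ₖ σX) Q)

/-- Terms with `Z` on `A_O` go to the `A`-first half, terms with `Z` on `B_O` to the other, and the
rest is shared equally. The halves are linear in `M`, so they come from a splitting of `Wact`
itself; its two parts cannot both be positive, as `Wact` would then be Araújo separable. -/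
theorem conditional_Wact (M : Matrix (QI 2 × QO 2) (QI 2 × QO 2) ℂ) :
    conditional 2 M Wact = halfAct M 1 (σZ ⊗ₖ id2) + halfAct M (-1) (id2 ⊗ₖ σZ) := by
  simp only [Wact, conditional_smul, conditional_smul_left, conditional_add, conditional_place,
    placeAB_add_right, placeAB_sub_right, halfAct]
  push_cast
  module

theorem coeffC_eq (M : Matrix (QI 2 × QO 2) (QI 2 × QO 2) ℂ) (c : Matrix (Fin 2) (Fin 2) ℂ) :
    coeffC M c = ∑ x : Fin 2, ∑ y : Fin 2,
      M.submatrix (fun x : Fin 2 => ((x, default) : QI 2 × QO 2)) (fun y => (y, default)) x y *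
        c y x := by
  simp only [coeffC, Fintype.sum_prod_type, Fintype.sum_unique]
  rfl

/-- Only the symmetric matrices `id2`, `σX`, `σZ` occur on `C_I`, so `M` enters through `m + mᵀ`,
which is positive. Each block is a congruence of it. -/
theorem halfAct_posSemidef {M : Matrix (QI 2 × QO 2) (QI 2 × QO 2) ℂ} (hM : IsCP M) {κ : ℝ}
    (hκ : κ * κ = 1) {Q : Matrix (Fin 2 × Fin 2) (Fin 2 × Fin 2) ℂ} (f : Fin 2 × Fin 2 → Fin 2)
    (hQ : Q = Matrix.diagonal fun g => sgn (f g)) : (halfAct M κ Q).PosSemidef := by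
  have h3 : (√3 : ℂ) ^ 2 = 3 := by
    rw [← Complex.ofReal_pow, Real.sq_sqrt (by norm_num)]; norm_num
  have hκ' : (κ : ℂ) ^ 2 = 1 := by rw [sq, ← Complex.ofReal_mul, hκ, Complex.ofReal_one]
  obtain ⟨m, hm⟩ : ∃ m : Matrix (Fin 2) (Fin 2) ℂ, m =
    M.submatrix (fun x : Fin 2 => ((x, default) : QI 2 × QO 2)) (fun y => (y, default)) := ⟨_, rfl⟩
  have hmp : m.PosSemidef := hm ▸ hM.submatrix _
  have h : halfAct M κ Q = blockOpAB fun g => (((1 / 32 : ℝ) : ℂ) •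
      (!![(√3 : ℂ), -Complex.I * κ; sgn (f g), -Complex.I * κ * √3 * sgn (f g)] * (m + mᵀ) *
        !![(√3 : ℂ), -Complex.I * κ; sgn (f g), -Complex.I * κ * √3 * sgn (f g)]ᴴ)) := by
    rw [halfAct, XX_add_YY_eq, id_sub_ZZ_eq, XY_sub_YX_eq, Z_sub_Z_eq, hQ, id_kronecker_id_eq]
    simp only [placeAB_antiparallel_diagonal, blockOpAB_add, smul_blockOpAB, coeffC_eq, ← hm]
    congr 1
    funext g
    have hs : sgn (f g) ^ 2 = 1 := by rw [sq, sgn_mul_self]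
    have hs2 : (starRingEnd ℂ) (sgn (f g)) = sgn (f g) := star_sgn (f g)
    ext i j
    simp only [Matrix.smul_apply, Matrix.mul_apply, Matrix.conjTranspose_apply, Pi.add_apply,
      Pi.smul_apply, Matrix.add_apply, Fin.sum_univ_two, Matrix.transpose_apply]
    fin_cases i <;> fin_cases j <;>
      simp [id2, σX, σY, σZ, hs2] <;> ring_nf <;>
      simp only [Complex.I_sq, h3, hκ', hs] <;> ring
  rw [h]
  exact blockOpAB_posSemidef fun g =>
    ((hmp.add hmp.transpose).mul_mul_conjTranspose_same _).smul
      (Complex.zero_le_real.2 (by norm_num))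

/-- Every term carries the identity on `B_O`, so `B` cannot signal to `A`. Terms with `Z` on `A_O`
carry a traceless Pauli on `B_I` and drop out of the total probability. -/
theorem isCompatibleFirst_halfAct_zero {M : Matrix (QI 2 × QO 2) (QI 2 × QO 2) ℂ} (hM : IsCP M) :
    IsCompatibleFirst 0 (halfAct M 1 (σZ ⊗ₖ id2)) := by
  refine isCompatibleFirst_of_noSignallingTo
    (halfAct_posSemidef hM (by norm_num) _ Z_kronecker_id_eq) ?_ ?_
  · intro L L' h0 h0' h
    obtain ⟨A, B, rfl⟩ := exists_eq_localsAB L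
    obtain ⟨A', B', rfl⟩ := exists_eq_localsAB L'
    have hA : IsCPTP A := h0
    have hA' : IsCPTP A' := h0'
    have hB : IsCPTP B := (h 1 (by decide)).1
    have hB' : IsCPTP B' := (h 1 (by decide)).2
    simp only [halfAct, born_add, born_sub, born_smul, placeAB_add_left, placeAB_sub_left,
      born_placeAB_kronecker, hA.trace_mul_kronecker_id2, hA'.trace_mul_kronecker_id2,
      hB.trace_mul_kronecker_id2, hB'.trace_mul_kronecker_id2, trace_σX, trace_σY, trace_σZ]
    ring
  · intro L L' h h'
    obtain ⟨A, B, rfl⟩ := exists_eq_localsAB L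
    obtain ⟨A', B', rfl⟩ := exists_eq_localsAB L'
    obtain rfl : A' = A := (h 0 rfl).2
    have hB : IsCPTP B := (h' 1 (by decide)).1
    have hB' : IsCPTP B' := (h' 1 (by decide)).2
    simp only [halfAct, born_add, born_sub, born_smul, placeAB_add_left, placeAB_sub_left,
      born_placeAB_kronecker,
      hB.trace_mul_kronecker_id2, hB'.trace_mul_kronecker_id2]

theorem isCompatibleFirst_halfAct_one {M : Matrix (QI 2 × QO 2) (QI 2 × QO 2) ℂ} (hM : IsCP M) :
    IsCompatibleFirst 1 (halfAct M (-1) (id2 ⊗ₖ σZ)) := by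
  refine isCompatibleFirst_of_noSignallingTo
    (halfAct_posSemidef hM (by norm_num) _ id_kronecker_Z_eq) ?_ ?_
  · intro L L' h0 h0' h
    obtain ⟨A, B, rfl⟩ := exists_eq_localsAB L
    obtain ⟨A', B', rfl⟩ := exists_eq_localsAB L'
    have hB : IsCPTP B := h0
    have hB' : IsCPTP B' := h0'
    have hA : IsCPTP A := (h 0 (by decide)).1
    have hA' : IsCPTP A' := (h 0 (by decide)).2
    simp only [halfAct, born_add, born_sub, born_smul, placeAB_add_left, placeAB_sub_left,
      born_placeAB_kronecker, hA.trace_mul_kronecker_id2, hA'.trace_mul_kronecker_id2,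
      hB.trace_mul_kronecker_id2, hB'.trace_mul_kronecker_id2, trace_σX, trace_σY, trace_σZ]
    ring
  · intro L L' h h'
    obtain ⟨A, B, rfl⟩ := exists_eq_localsAB L
    obtain ⟨A', B', rfl⟩ := exists_eq_localsAB L'
    obtain rfl : B' = B := (h 1 rfl).2
    have hA : IsCPTP A := (h' 0 (by decide)).1
    have hA' : IsCPTP A' := (h' 0 (by decide)).2
    simp only [halfAct, born_add, born_sub, born_smul, placeAB_add_left, placeAB_sub_left,
      born_placeAB_kronecker,
      hA.trace_mul_kronecker_id2, hA'.trace_mul_kronecker_id2]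

/-- Every term with `Z` on one outgoing system has a traceless Pauli on the other party's incoming
system, next to an identity on its outgoing one. All dependence on the CPTP maps of `A` and `B`
disappears, for any operation of `C`. -/
theorem isCompatibleFirst_Wact : IsCompatibleFirst 2 Wact := by
  have key : ∀ {A B A' B' : Matrix (Fin 2 × Fin 2) (Fin 2 × Fin 2) ℂ}
      {C : Matrix (Fin 2 × Fin 1) (Fin 2 × Fin 1) ℂ}, IsCPTP A → IsCPTP A' → IsCPTP B →
      IsCPTP B' → born Wact (locals A B C) = born Wact (locals A' B' C) := by
    intro A B A' B' C hA hA' hB hB'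
    simp only [Wact, born_add, born_sub, born_smul, place_add_left, place_sub_left,
      place_add_right, place_sub_right, born_place_kronecker, hA.trace_mul_kronecker_id2,
      hA'.trace_mul_kronecker_id2, hB.trace_mul_kronecker_id2, hB'.trace_mul_kronecker_id2,
      trace_σX, trace_σY, trace_σZ]
    ring
  refine isCompatibleFirst_of_noSignallingTo Wact_posSemidef ?_ ?_
  · intro L L' h2 h2' h
    obtain ⟨A, B, C, rfl⟩ := exists_eq_locals L
    obtain ⟨A', B', C', rfl⟩ := exists_eq_locals L'
    obtain rfl : C = C' := h2.unique h2'
    exact key (h 0 (by decide)).1 (h 0 (by decide)).2 (h 1 (by decide)).1 (h 1 (by decide)).2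
  · intro L L' h h'
    obtain ⟨A, B, C, rfl⟩ := exists_eq_locals L
    obtain ⟨A', B', C', rfl⟩ := exists_eq_locals L'
    obtain rfl : C' = C := (h 2 rfl).2
    exact key (h' 0 (by decide)).1 (h' 0 (by decide)).2 (h' 1 (by decide)).1 (h' 1 (by decide)).2

theorem isOGSeparable_Wact : IsOGSeparable 3 QI QO Wact := by
  have e : Wact = ∑ k, (![0, 0, Wact] : Fin 3 → Op QI QO) k := by simp [Fin.sum_univ_three]
  have hP := isCompatibleFirst_Wact.1
  rw [e] at hP ⊢
  refine isOGSeparable_sum (n := 1) hP (fun k => ?_) fun k M hM => ?_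
  · fin_cases k
    exacts [.zero 0, .zero 1, isCompatibleFirst_Wact]
  · fin_cases k
    · exact (conditional_zero _ M).symm ▸ isOGSeparable_zero 2 _ _
    · exact (conditional_zero _ M).symm ▸ isOGSeparable_zero 2 _ _
    · change IsOGSeparable 2 _ _ (conditional 2 M Wact)
      rw [conditional_Wact]
      exact isOGSeparable_two (isCompatibleFirst_halfAct_zero hM)
        (isCompatibleFirst_halfAct_one hM)

end OG

/-! ### The causal witness `Sact` -/

section Witness

theorem trace_mul_nonneg {X : Type*} [Fintype X] {S W : Matrix X X ℂ} (hS : S.PosSemidef)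
    (hW : W.PosSemidef) : 0 ≤ (S * W).trace := by
  classical
  obtain ⟨m, v, rfl⟩ := Matrix.posSemidef_iff_eq_sum_vecMulVec.1 hW
  rw [Matrix.mul_sum, Matrix.trace_sum]
  refine Finset.sum_nonneg fun k _ => ?_
  rw [Matrix.mul_vecMulVec, Matrix.trace_vecMulVec, dotProduct_comm]
  exact hS.dotProduct_mulVec_nonneg _

theorem tensor_locals_sub_left (A A' B : Matrix (Fin 2 × Fin 2) (Fin 2 × Fin 2) ℂ)
    (C : Matrix (Fin 2 × Fin 1) (Fin 2 × Fin 1) ℂ) :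
    tensor (locals (A - A') B C) = tensor (locals A B C) - tensor (locals A' B C) := by
  ext i j
  simp only [tensor, Matrix.of_apply, Fin.prod_univ_three, Matrix.sub_apply]
  change (A (i 0) (j 0) - A' (i 0) (j 0)) * B (i 1) (j 1) * C (i 2) (j 2) =
    A (i 0) (j 0) * B (i 1) (j 1) * C (i 2) (j 2) - A' (i 0) (j 0) * B (i 1) (j 1) * C (i 2) (j 2)
  ring

theorem tensor_locals_sub_right (A B B' : Matrix (Fin 2 × Fin 2) (Fin 2 × Fin 2) ℂ)
    (C : Matrix (Fin 2 × Fin 1) (Fin 2 × Fin 1) ℂ) :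
    tensor (locals A (B - B') C) = tensor (locals A B C) - tensor (locals A B' C) := by
  ext i j
  simp only [tensor, Matrix.of_apply, Fin.prod_univ_three, Matrix.sub_apply]
  change A (i 0) (j 0) * (B (i 1) (j 1) - B' (i 1) (j 1)) * C (i 2) (j 2) =
    A (i 0) (j 0) * B (i 1) (j 1) * C (i 2) (j 2) - A (i 0) (j 0) * B' (i 1) (j 1) * C (i 2) (j 2)
  ring

/-- These channels measure `P` and encode the result, or its opposite, in the `Z` basis; their
difference is `P ⊗ₖ σZ`. -/
theorem isCPTP_half_one_add {P : Matrix (Fin 2) (Fin 2) ℂ} (hP : P.IsHermitian) (hP2 : P * P = 1)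
    {r : ℝ} (hr : r * r = 1) : IsCPTP (((1 / 2 : ℝ) : ℂ) • (1 + (r : ℂ) • (P ⊗ₖ σZ))) := by
  have hr' : (r : ℂ) * r = 1 := by rw [← Complex.ofReal_mul, hr, Complex.ofReal_one]
  refine ⟨(posSemidef_one_add ((IsHermitian.kronecker hP isHermitian_σZ).ofReal_smul r) ?_).smul
    (Complex.zero_le_real.2 (by norm_num)), fun x x' => ?_⟩
  · rw [Matrix.smul_mul, Matrix.mul_smul, smul_smul, hr', one_smul, ← Matrix.mul_kronecker_mul,
        hP2, σZ_mul_self, Matrix.one_kronecker_one]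
  · simp [Fin.sum_univ_two, σZ, Matrix.one_apply]
    split_ifs <;> ring

theorem isCP_one_add {P : Matrix (Fin 2) (Fin 2) ℂ} (hP : P.IsHermitian) (hP2 : P * P = 1) :
    IsCP (1 + P ⊗ₖ id2) := by
  refine posSemidef_one_add (IsHermitian.kronecker hP isHermitian_id2) ?_
  rw [← Matrix.mul_kronecker_mul, hP2, id2, one_mul, Matrix.one_kronecker_one]

/-- On `B` the operator is a difference of two channels, on `A` a difference of two CP maps, and on
`C` the identity; no signalling to `A` kills it. -/
theorem trace_place_mul_of_first_A {P : Matrix (Fin 2) (Fin 2) ℂ} (hP : P.IsHermitian)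
    (hP2 : P * P = 1) {V : Op QI QO} (hV : IsCompatibleFirst 0 V) :
    (place id2 (P ⊗ₖ P) (id2 ⊗ₖ σZ) * V).trace = 0 := by
  have h1 : ∀ A : Matrix (Fin 2 × Fin 2) (Fin 2 × Fin 2) ℂ, IsCP A →
      (tensor (locals A (P ⊗ₖ σZ) 1) * V).trace = 0 := by
    intro A hA
    have h := hV.2
      (locals A (((1 / 2 : ℝ) : ℂ) • (1 + ((1 : ℝ) : ℂ) • (P ⊗ₖ σZ))) 1)
      (locals A (((1 / 2 : ℝ) : ℂ) • (1 + ((-1 : ℝ) : ℂ) • (P ⊗ₖ σZ))) 1)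
      (by rintro k rfl; exact ⟨hA, rfl⟩) (by
        intro k hk
        fin_cases k
        · exact absurd rfl hk
        · exact ⟨isCPTP_half_one_add hP hP2 (by norm_num), isCPTP_half_one_add hP hP2 (by norm_num)⟩
        · exact ⟨isCPTP_one (X := Fin 2) (Y := Fin 1), isCPTP_one (X := Fin 2) (Y := Fin 1)⟩)
    have e : P ⊗ₖ σZ = ((1 / 2 : ℝ) : ℂ) • (1 + ((1 : ℝ) : ℂ) • (P ⊗ₖ σZ)) -
        ((1 / 2 : ℝ) : ℂ) • (1 + ((-1 : ℝ) : ℂ) • (P ⊗ₖ σZ)) := by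
      push_cast
      module
    rw [e, tensor_locals_sub_right, sub_mul, Matrix.trace_sub, sub_eq_zero]
    exact h
  have e : P ⊗ₖ id2 = (1 + P ⊗ₖ id2) - 1 := by abel
  rw [place_kronecker, e, tensor_locals_sub_left, sub_mul, Matrix.trace_sub, id2,
    Matrix.one_kronecker_one, h1 _ Matrix.PosSemidef.one, sub_zero]
  exact h1 _ (isCP_one_add hP hP2)

theorem trace_place_mul_of_first_B {P : Matrix (Fin 2) (Fin 2) ℂ} (hP : P.IsHermitian)
    (hP2 : P * P = 1) {V : Op QI QO} (hV : IsCompatibleFirst 1 V) :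
    (place id2 (P ⊗ₖ P) (σZ ⊗ₖ id2) * V).trace = 0 := by
  have h1 : ∀ B : Matrix (Fin 2 × Fin 2) (Fin 2 × Fin 2) ℂ, IsCP B →
      (tensor (locals (P ⊗ₖ σZ) B 1) * V).trace = 0 := by
    intro B hB
    have h := hV.2
      (locals (((1 / 2 : ℝ) : ℂ) • (1 + ((1 : ℝ) : ℂ) • (P ⊗ₖ σZ))) B 1)
      (locals (((1 / 2 : ℝ) : ℂ) • (1 + ((-1 : ℝ) : ℂ) • (P ⊗ₖ σZ))) B 1)
      (by rintro k rfl; exact ⟨hB, rfl⟩) (by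
        intro k hk
        fin_cases k
        · exact ⟨isCPTP_half_one_add hP hP2 (by norm_num), isCPTP_half_one_add hP hP2 (by norm_num)⟩
        · exact absurd rfl hk
        · exact ⟨isCPTP_one (X := Fin 2) (Y := Fin 1), isCPTP_one (X := Fin 2) (Y := Fin 1)⟩)
    have e : P ⊗ₖ σZ = ((1 / 2 : ℝ) : ℂ) • (1 + ((1 : ℝ) : ℂ) • (P ⊗ₖ σZ)) -
        ((1 / 2 : ℝ) : ℂ) • (1 + ((-1 : ℝ) : ℂ) • (P ⊗ₖ σZ)) := by
      push_cast
      module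
    rw [e, tensor_locals_sub_left, sub_mul, Matrix.trace_sub, sub_eq_zero]
    exact h
  have e : P ⊗ₖ id2 = (1 + P ⊗ₖ id2) - 1 := by abel
  rw [place_kronecker, e, tensor_locals_sub_right, sub_mul, Matrix.trace_sub, id2,
    Matrix.one_kronecker_one, h1 _ Matrix.PosSemidef.one, sub_zero]
  exact h1 _ (isCP_one_add hP hP2)

/-- The blocks of `Sact`, corrected by a term that vanishes on the process matrices compatible
with one of the two orders, where `η = 1` for `A ≺ B ≺ C` and `η = -1` for `B ≺ A ≺ C`. -/
noncomputable def blockS (η : ℝ) (g : Fin 2 × Fin 2) :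
    Matrix (Fin 2 × Fin 2) (Fin 2 × Fin 2) ℂ :=
  ((1 - sgn g.1 * sgn g.2) / 2) • (id2 ⊗ₖ id2 - ((1 / √3 : ℝ) : ℂ) • (σZ ⊗ₖ σZ)) +
    (sgn g.2 - sgn g.1) • (((η / 3 : ℝ) : ℂ) • (id2 ⊗ₖ σX) -
      ((1 / √3 : ℝ) : ℂ) • (1 / 2 : ℂ) • (σX ⊗ₖ σY) + (1 / 6 : ℂ) • (σY ⊗ₖ σX))

theorem neg_Z_sub_Z_eq : id2 ⊗ₖ σZ - σZ ⊗ₖ id2 = antiparallel ((-2 : ℂ) • σZ) := by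
  rw [← neg_sub, Z_sub_Z_eq]
  ext a b
  simp only [antiparallel, Matrix.neg_apply, Matrix.of_apply, Matrix.smul_apply, smul_eq_mul]
  split_ifs <;> ring

/-- The coefficient `1/3` turns the `-1/6` in front of `1Z + Z1` into `1/6` in front of `1Z - Z1`.
Now every term vanishes when the two outgoing values agree. -/
theorem Sact_add_of_first_A : Sact +
    (1 / 3 : ℂ) • place id2 (σX ⊗ₖ σX + σY ⊗ₖ σY) (id2 ⊗ₖ σZ) = blockOp (blockS 1) := by
  simp only [Sact, place_add_right, place_sub_right]
  rw [neg_Z_sub_Z_eq, XX_add_YY_eq, id_sub_ZZ_eq, XY_sub_YX_eq, Z_kronecker_id_eq,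
    id_kronecker_Z_eq, id_kronecker_id_eq, Z_kronecker_Z_eq]
  simp only [place_antiparallel_diagonal, blockOp_add, blockOp_sub, smul_blockOp]
  congr 1
  funext g
  simp only [blockS, Pi.add_apply, Pi.sub_apply, Pi.smul_apply, Matrix.kronecker_smul]
  push_cast
  module

theorem Sact_add_of_first_B : Sact +
    (1 / 3 : ℂ) • place id2 (σX ⊗ₖ σX + σY ⊗ₖ σY) (σZ ⊗ₖ id2) = blockOp (blockS (-1)) := by
  simp only [Sact, place_add_right, place_sub_right]
  rw [neg_Z_sub_Z_eq, XX_add_YY_eq, id_sub_ZZ_eq, XY_sub_YX_eq, Z_kronecker_id_eq,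
    id_kronecker_Z_eq, id_kronecker_id_eq, Z_kronecker_Z_eq]
  simp only [place_antiparallel_diagonal, blockOp_add, blockOp_sub, smul_blockOp]
  congr 1
  funext g
  simp only [blockS, Pi.add_apply, Pi.sub_apply, Pi.smul_apply, Matrix.kronecker_smul]
  push_cast
  module

theorem blockS_posSemidef {η : ℝ} (hη : η * η = 1) (g : Fin 2 × Fin 2) :
    (blockS η g).PosSemidef := by
  by_cases hg : g.1 = g.2
  · simpa [blockS, hg, sgn_mul_self] using Matrix.PosSemidef.zero
  · have hg' : sgn g.2 = -sgn g.1 := by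
      obtain ⟨a, b⟩ := g
      fin_cases a <;> fin_cases b <;> simp_all [sgn]
    have ha : sgn g.1 ^ 2 = 1 := by rw [sq, sgn_mul_self]
    have ha2 : (starRingEnd ℂ) (sgn g.1) = sgn g.1 := star_sgn g.1
    obtain ⟨s, hs⟩ : ∃ s : ℝ, s = 1 / √3 := ⟨_, rfl⟩
    have hs2 : s ^ 2 = 1 / 3 := by rw [hs, div_pow, Real.sq_sqrt (by norm_num)]; norm_num
    have hs0 : 0 ≤ s := by rw [hs]; positivity
    have hs1 : s ≤ 1 := by nlinarith
    have hs2' : (s : ℂ) ^ 2 = 1 / 3 := by rw [← Complex.ofReal_pow, hs2]; norm_num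
    have hs3' : (s : ℂ) ^ 3 = s / 3 := by rw [pow_succ, hs2']; ring
    have hη' : (η : ℂ) ^ 2 = 1 := by rw [sq, ← Complex.ofReal_mul, hη, Complex.ofReal_one]
    have h : ∀ u w : Fin 2 × Fin 2 → ℂ,
        (((3 / 2 * (1 + s) : ℝ) : ℂ) • Matrix.vecMulVec u (star u) +
        ((3 / 2 * (1 - s) : ℝ) : ℂ) • Matrix.vecMulVec w (star w)).PosSemidef := fun u w =>
      ((Matrix.posSemidef_vecMulVec_self_star u).smul
        (Complex.zero_le_real.2 (by linarith))).add
      ((Matrix.posSemidef_vecMulVec_self_star w).smul (Complex.zero_le_real.2 (by linarith)))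
    -- The vectors are the columns of the block at `|00⟩` and `|10⟩`, whose mutual entry is zero.
    -- The weights are the inverses of the pivots `1 - s` and `1 + s`, since `(1 - s)(1 + s) = 2/3`;
    -- the Schur complement vanishes, so the block has rank two.
    convert h
      (fun x => !![1 - (s : ℂ), -(2 / 3) * η * sgn g.1;
        0, Complex.I * sgn g.1 * (s - 1 / 3)] x.1 x.2)
      (fun x => !![0, Complex.I * sgn g.1 * (s + 1 / 3);
        1 + (s : ℂ), -(2 / 3) * η * sgn g.1] x.1 x.2) using 1
    rw [blockS, hg', ← hs]
    ext ⟨c, q⟩ ⟨c', q'⟩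
    fin_cases c <;> fin_cases q <;> fin_cases c' <;> fin_cases q' <;>
      simp [id2, σX, σY, σZ, Matrix.vecMulVec_apply, ha2] <;> ring_nf <;>
      simp only [Complex.I_sq, ha, hs2', hs3', hη'] <;> ring

theorem isCausalWitness_Sact : IsCausalWitness Sact := by
  have hA := blockOp_posSemidef (blockS_posSemidef (η := 1) (by norm_num))
  have hB := blockOp_posSemidef (blockS_posSemidef (η := -1) (by norm_num))
  rw [← Sact_add_of_first_A] at hA
  rw [← Sact_add_of_first_B] at hB
  constructor
  · have h : (place id2 (σX ⊗ₖ σX + σY ⊗ₖ σY) (id2 ⊗ₖ σZ)).IsHermitian :=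
      place_isHermitian isHermitian_id2
        ((IsHermitian.kronecker isHermitian_σX isHermitian_σX).add
          (IsHermitian.kronecker isHermitian_σY isHermitian_σY))
        (IsHermitian.kronecker isHermitian_id2 isHermitian_σZ)
    have h' := hA.1.sub (h.ofReal_smul (1 / 3))
    rwa [Complex.ofReal_div, Complex.ofReal_one, Complex.ofReal_ofNat, add_sub_cancel_right] at h'
  · intro W hW
    obtain ⟨V, V', hV, hV', rfl⟩ := isAraujoSeparable_iff.1 hW
    have h1 := trace_mul_nonneg hA hV.1.1
    have h2 := trace_mul_nonneg hB hV'.1.1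
    rw [add_mul, Matrix.trace_add, Matrix.smul_mul, Matrix.trace_smul, place_add_left, add_mul,
      Matrix.trace_add, trace_place_mul_of_first_A isHermitian_σX σX_mul_self hV,
      trace_place_mul_of_first_A isHermitian_σY σY_mul_self hV, add_zero, smul_zero,
      add_zero] at h1
    rw [add_mul, Matrix.trace_add, Matrix.smul_mul, Matrix.trace_smul, place_add_left, add_mul,
      Matrix.trace_add, trace_place_mul_of_first_B isHermitian_σX σX_mul_self hV',
      trace_place_mul_of_first_B isHermitian_σY σY_mul_self hV', add_zero, smul_zero,
      add_zero] at h2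
    rw [mul_add, Matrix.trace_add]
    exact add_nonneg h1 h2

theorem not_isAraujoSeparable_Wact : ¬ IsAraujoSeparable Wact := by
  intro h
  have h1 := isCausalWitness_Sact.2 Wact h
  rw [trace_Sact_mul_Wact] at h1
  exact absurd (Complex.zero_le_real.1 h1) (not_le.2 two_sub_four_div_sqrt_three_neg)

end Witness

end ProcMat

theorem proposition1 :
    (∀ {I : Fin 3 → Type*} {O : Fin 3 → Type*}
        [∀ k, Fintype (I k)] [∀ k, Fintype (O k)] [∀ k, DecidableEq (I k)] [Unique (O 2)]
        (W : Op I O), IsAraujoSeparable W ↔ IsExtensiblyOGSeparable W) ∧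
    IsOGSeparable 3 QI QO Wact ∧
    IsCausalWitness Sact ∧
    (Sact * Wact).trace = ((2 - 4 / √3 : ℝ) : ℂ) ∧
    (2 - 4 / √3 : ℝ) < 0 ∧
    ¬ IsAraujoSeparable Wact ∧
    ¬ IsExtensiblyOGSeparable Wact := by
  have h : ¬ IsAraujoSeparable Wact := not_isAraujoSeparable_Wact
  exact ⟨fun W => isAraujoSeparable_iff_isExtensiblyOGSeparable, isOGSeparable_Wact,
    isCausalWitness_Sact, trace_Sact_mul_Wact, two_sub_four_div_sqrt_three_neg, h,
    fun h' => h (isAraujoSeparable_iff_isExtensiblyOGSeparable.2 h')⟩
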